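/- Let $M$ be a smooth manifold (finite-dimensional, Hausdorff, second countable) and let $(A\to M,\rho,[\cdot,\cdot])$ be a Lie algebroid. The bundles $TM\oplus A^*$ and $A\oplus T^*M$ are in duality by $\langle(X,\alpha),(a,\theta)\rangle=\alpha(a)+\theta(X)$, and $(\rho,\rho^t)\colon A\oplus T^*M\to TM\oplus A^*$. The bundle $A\oplus T^*M$ is a degenerate Courant algebroid with anchor $\rho\circ\mathrm{pr}_A$, pairing $\langle(a_1,\theta_1),(a_2,\theta_2)\rangle_d=\theta_2(\rho(a_1))+\theta_1(\rho(a_2))$ and bracket $[(a_1,\theta_1),(a_2,\theta_2)]_d=([a_1,a_2],\mathcal L_{\rho(a_1)}\theta_2-i_{\rho(a_2)}d\theta_1)$. An *$A$-Manin pair* is a Courant algebroid $C\to M$ (anchor $c$, pairing $\langle\cdot,\cdot\rangle_C$, bracket $[\![\cdot,\cdot]\!]_C$) with a Dirac structure $U\subseteq C$, together with an injective vector bundle morphism $\iota\colon U\to TM\oplus A^*$ such that $c|_U=\mathrm{pr}_{TM}\circ\iota$, and a morphism $\Phi\colon A\oplus T^*M\to C$ of (degenerate) Courant algebroids such that $\Phi(A\oplus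 T^*M)+U=C$ and $\langle u,\Phi(\tau)\rangle_C=\langle\iota(u),\tau\rangle$ for all $u\in U$ and $\tau\in A\oplus T^*M$ over the same point. A *Dirac bialgebroid* over $A$ is a triple $(A,U,\iota)$, with $U$ a Lie algebroid and $\iota\colon U\to TM\oplus A^*$ an injective vector bundle morphism compatible with the anchors, such that $U$ and $\iota$ are the Dirac structure and the injective morphism of some $A$-Manin pair. Two $A$-Manin pairs, respectively two Dirac bialgebroids over $A$, are *equivalent* if they define the same Lie algebroid $\iota(U)=\iota'(U')$ in $TM\oplus A^*$. **Claim.** 1. The map that sends the class of $(C,U)$, with structure maps $\iota,\Phi$, to the class of $(A,U,\iota)$ is a bijection from the equivalence classes of $A$-Manin pairs to the equivalence classes of Dirac bialgebroids over $A$. 2. If two $A$-Manin pairs $(C,U,\iota,\Phi)$ and $(C',U',\iota',\Phi')$ are equivalent, then there are an isomorphism of Courant algebroids $\Theta\colon C\to C'$ and a vector bundle isomorphism $\psi\colon U\to U'$ with $\Theta|_U=\psi$, $\iota'\circ\psi=\iota$ and $\Theta\circ\Phi=\Phi'$. 3. Let $(C,U,\iota,\Phi)$ be an $A$-Manin pair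 and let $U^\circ\subseteq A\oplus T^*M$ be the annihilator of $\iota(U)$. Then $\Phi(\tau)\in U$ if and only if $\tau\in U^\circ$. For $\tau\in U^\circ$ one has $(\rho,\rho^t)\tau\in\iota(U)$ and $\iota(\Phi(\tau))=(\rho,\rho^t)\tau$, and $U^\circ$ is isotropic for $\langle\cdot,\cdot\rangle_d$. The vector bundle morphism $U\oplus A\oplus T^*M\to C$, $(u,\tau)\mapsto u\oplus\tau:=u+\Phi(\tau)$, induces an isomorphism $$\frac{U\oplus A\oplus T^*M}{\operatorname{graph}\bigl(-(\rho,\rho^t)|_{U^\circ}\colon U^\circ\to U\bigr)}\;\cong\; C$$ (where $U$ is identified with $\iota(U)$ in the denominator), under which $\Phi(\tau)=0\oplus\tau$. Moreover $c(u\oplus\tau)=\mathrm{pr}_{TM}(\iota(u))+\rho(\mathrm{pr}_A\tau)$, $$\langle u_1\oplus\tau_1,u_2\oplus\tau_2\rangle_C=\langle\iota(u_1),\tau_2\rangle+\langle\iota(u_2),\tau_1\rangle+\langle(\rho,\rho^t)\tau_2,\tau_1\rangle,$$ and $\mathcal Df=0\oplus(0,df)$ for $f\in C^\infty(M)$, where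 $\langle\mathcal Df,s\rangle_C=c(s)f$ for $s\in\Gamma(C)$. 4. With $(C,U,\iota,\Phi)$ as in 3, there is a Dorfman connection $\Delta\colon\Gamma(TM\oplus A^*)\times\Gamma(A\oplus T^*M)\to\Gamma(A\oplus T^*M)$ that extends $\mathcal L^U$, that is, such that the dull bracket on $\Gamma(TM\oplus A^*)$ dual to $\Delta$ restricts to the bracket of $\Gamma(U)\cong\iota(\Gamma(U))$. For every such $\Delta$, put $$\nabla^{\mathrm{bas}}_a\nu=(\rho,\rho^t)\bigl(\Delta_\nu(a,0)-(0,d\langle\nu,(a,0)\rangle)\bigr)+\mathcal L_a\nu,\qquad \mathcal L_a(X,\alpha)=([\rho(a),X],\mathcal L_a\alpha).$$ Then for all $u_1,u_2\in\Gamma(U)$ and $\tau_1,\tau_2\in\Gamma(A\oplus T^*M)$, with $U$ identified with $\iota(U)$, $$[\![u_1\oplus\tau_1,u_2\oplus\tau_2]\!]_C=\bigl([u_1,u_2]_U+\nabla^{\mathrm{bas}}_{\mathrm{pr}_A\tau_1}u_2-\nabla^{\mathrm{bas}}_{\mathrm{pr}_A\tau_2}u_1\bigr)\oplus\bigl([\tau_1,\tau_2]_d+\Delta_{u_1}\tau_2-\Delta_{u_2}\tau_1+(0,d\langle\tau_1,u_2\rangle)\bigr),$$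 the first component being a section of $\iota(U)$. -/

import Mathlib

open Bundle Set
open scoped Manifold ContDiff

universe uE uM w w₁ w₂

noncomputable section

namespace DiracManin

section Bundles

variable {E : Type uE} [NormedAddCommGroup E] [NormedSpace ℝ E]
  {M : Type uM} [TopologicalSpace M] [ChartedSpace E M]

/-- A smooth real vector bundle of finite rank over the manifold `M` (modelled on `E`), with
model fibre `F` and fibres `fib x`. -/
structure VBundle (E : Type uE) [NormedAddCommGroup E] [NormedSpace ℝ E]
    (M : Type uM) [TopologicalSpace M] [ChartedSpace E M] where
  F : Type w
  [normF : NormedAddCommGroup F]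
  [spaceF : NormedSpace ℝ F]
  [finF : FiniteDimensional ℝ F]
  fib : M → Type w
  [grp : ∀ x, AddCommGroup (fib x)]
  [mod : ∀ x, Module ℝ (fib x)]
  [top : ∀ x, TopologicalSpace (fib x)]
  [totTop : TopologicalSpace (TotalSpace F fib)]
  [fibre : FiberBundle F fib]
  [vector : VectorBundle ℝ F fib]
  [smooth : ContMDiffVectorBundle ∞ F fib 𝓘(ℝ, E)]

attribute [instance] VBundle.normF VBundle.spaceF VBundle.finF VBundle.grp VBundle.mod
  VBundle.top VBundle.totTop VBundle.fibre VBundle.vector VBundle.smooth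

/-- The smooth sections of `V`. -/
abbrev Sec (V : VBundle.{uE, uM, w} E M) : Type (max uM w) :=
  ContMDiffSection 𝓘(ℝ, E) V.F ∞ V.fib

/-- The smooth functions on `M`. -/
abbrev Fn (E : Type uE) [NormedAddCommGroup E] [NormedSpace ℝ E]
    (M : Type uM) [TopologicalSpace M] [ChartedSpace E M] : Type uM :=
  ContMDiffMap 𝓘(ℝ, E) 𝓘(ℝ, ℝ) M ℝ ∞

/-- The product `f s` of a smooth function and a smooth section. -/
def fmul {V : VBundle.{uE, uM, w} E M} (f : Fn E M) (s : Sec V) : Sec V :=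
  ⟨fun x => f x • s x, f.contMDiff.smul_section s.contMDiff⟩

/-- The tangent bundle. -/
abbrev tangent (E : Type uE) [NormedAddCommGroup E] [NormedSpace ℝ E] [FiniteDimensional ℝ E]
    (M : Type uM) [TopologicalSpace M] [ChartedSpace E M] [IsManifold 𝓘(ℝ, E) ∞ M] :
    VBundle.{uE, uM, uE} E M where
  F := E
  fib := fun x => TangentSpace 𝓘(ℝ, E) x

/-- The dual bundle. -/
abbrev VBundle.dual (V : VBundle.{uE, uM, w} E M) : VBundle.{uE, uM, w} E M where
  F := V.F →L[ℝ] ℝ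
  fib := fun x => V.fib x →L[ℝ] Trivial M ℝ x

/-- The direct sum of two bundles. -/
abbrev VBundle.prod (V : VBundle.{uE, uM, w₁} E M) (W : VBundle.{uE, uM, w₂} E M) :
    VBundle.{uE, uM, max w₁ w₂} E M where
  F := V.F × W.F
  fib := fun x => V.fib x × W.fib x

/-- A morphism of vector bundles over the identity of `M`: a fibrewise linear map which is smooth
as a map of total spaces. -/
structure VBHom (V : VBundle.{uE, uM, w₁} E M) (W : VBundle.{uE, uM, w₂} E M) where
  app : ∀ x, V.fib x →L[ℝ] W.fib x
  smooth_app : ContMDiff (𝓘(ℝ, E).prod 𝓘(ℝ, V.F)) (𝓘(ℝ, E).prod 𝓘(ℝ, W.F)) ∞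
    (fun p : TotalSpace V.F V.fib => (⟨p.1, app p.1 p.2⟩ : TotalSpace W.F W.fib))

/-- The map on sections induced by a bundle morphism. -/
def VBHom.map {V : VBundle.{uE, uM, w₁} E M} {W : VBundle.{uE, uM, w₂} E M} (φ : VBHom V W)
    (s : Sec V) : Sec W :=
  ⟨fun x => φ.app x (s x), φ.smooth_app.comp s.contMDiff⟩

/-- The section `(s, t)` of a direct sum. -/
def pairSec {V : VBundle.{uE, uM, w₁} E M} {W : VBundle.{uE, uM, w₂} E M}
    (s : Sec V) (t : Sec W) : Sec (V.prod W) :=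
  ⟨fun x => (s x, t x), fun x => by
    rw [contMDiffAt_section]
    exact ((contMDiffAt_section x).1 (s.contMDiff x)).prodMk_space
      ((contMDiffAt_section x).1 (t.contMDiff x))⟩

/-- The first component of a section of a direct sum. -/
def Sec.fst {V : VBundle.{uE, uM, w₁} E M} {W : VBundle.{uE, uM, w₂} E M}
    (s : Sec (V.prod W)) : Sec V :=
  ⟨fun x => (s x).1, fun x => by
    rw [contMDiffAt_section]
    have h := (contMDiffAt_section x).1 (s.contMDiff x)
    exact (ContinuousLinearMap.fst ℝ V.F W.F).contMDiff.contMDiffAt.comp x h⟩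

/-- The second component of a section of a direct sum. -/
def Sec.snd {V : VBundle.{uE, uM, w₁} E M} {W : VBundle.{uE, uM, w₂} E M}
    (s : Sec (V.prod W)) : Sec W :=
  ⟨fun x => (s x).2, fun x => by
    rw [contMDiffAt_section]
    have h := (contMDiffAt_section x).1 (s.contMDiff x)
    exact (ContinuousLinearMap.snd ℝ V.F W.F).contMDiff.contMDiffAt.comp x h⟩

/-- The smooth function obtained by evaluating a section of the dual bundle on a section. -/
def evalSec {V : VBundle.{uE, uM, w} E M} (σ : Sec V.dual) (s : Sec V) : Fn E M :=
  ⟨fun x => σ x (s x), by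
    have := ContMDiff.clm_bundle_apply (F₁ := V.F) (F₂ := ℝ) (E₁ := V.fib) (E₂ := Trivial M ℝ)
      (n := ∞) (IB := 𝓘(ℝ, E)) (b := fun x : M => x) σ.contMDiff s.contMDiff
    intro x
    exact (contMDiffAt_section x).1 (this x)⟩

theorem fn_mdiff (f : Fn E M) (x : M) : MDifferentiableAt 𝓘(ℝ, E) 𝓘(ℝ, ℝ) f x :=
  f.contMDiff.mdifferentiable (by simp) x

theorem evalSec_add {V : VBundle.{uE, uM, w} E M} (σ : Sec V.dual) (s t : Sec V) :
    evalSec σ (s + t) = evalSec σ s + evalSec σ t := by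
  ext x
  exact map_add (σ x) (s x) (t x)

theorem evalSec_fmul {V : VBundle.{uE, uM, w} E M} (σ : Sec V.dual) (f : Fn E M) (s : Sec V) :
    evalSec σ (fmul f s) = f * evalSec σ s := by
  ext x
  exact map_smul (σ x) (f x) (s x)

theorem fmul_add {V : VBundle.{uE, uM, w} E M} (f : Fn E M) (s t : Sec V) : fmul f (s + t) = fmul f s + fmul f t := by
  ext x
  exact smul_add (f x) (s x) (t x)

theorem add_fmul {V : VBundle.{uE, uM, w} E M} (f g : Fn E M) (s : Sec V) : fmul (f + g) s = fmul f s + fmul g s := by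
  ext x
  exact add_smul (f x) (g x) (s x)

end Bundles

section Tensorial

variable {E : Type uE} [NormedAddCommGroup E] [NormedSpace ℝ E] [FiniteDimensional ℝ E]
  {M : Type uM} [TopologicalSpace M] [ChartedSpace E M] [IsManifold 𝓘(ℝ, E) ∞ M] [T2Space M]

theorem exists_bump {x : M} {u : Set M} (hu : u ∈ nhds x) :
    ∃ ψ : Fn E M, tsupport ψ ⊆ u ∧ ∀ᶠ y in nhds x, ψ y = 1 := by
  obtain ⟨ψ, -, hψ⟩ := (SmoothBumpFunction.nhds_basis_tsupport (I := 𝓘(ℝ, E)) x).mem_iff.1 hu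
  exact ⟨⟨ψ, ψ.contMDiff⟩, hψ, ψ.eventuallyEq_one⟩

theorem exists_sec_germ {V : VBundle.{uE, uM, w} E M} {x : M} {u : Set M} (hu : IsOpen u)
    (hx : x ∈ u) {s : ∀ x, V.fib x}
    (hs : ContMDiffOn 𝓘(ℝ, E) (𝓘(ℝ, E).prod 𝓘(ℝ, V.F)) ∞
      (fun x => TotalSpace.mk' V.F x (s x)) u) :
    ∃ t : Sec V, ∀ᶠ y in nhds x, t y = s y := by
  obtain ⟨ψ, h1, h2⟩ := exists_bump (E := E) (hu.mem_nhds hx)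
  refine ⟨⟨fun y => ψ y • s y, ContMDiffOn.smul_section_of_tsupport (ψ := ψ) ψ.contMDiff.contMDiffOn
    hu h1 hs⟩, ?_⟩
  filter_upwards [h2] with y hy
  change ψ y • s y = s y
  rw [hy, one_smul]

theorem exists_sec_apply {V : VBundle.{uE, uM, w} E M} {x : M} (v : V.fib x) :
    ∃ s : Sec V, s x = v := by
  let t := trivializationAt V.F V.fib x
  have hx : x ∈ t.baseSet := FiberBundle.mem_baseSet_trivializationAt' x
  have h : ContMDiffOn 𝓘(ℝ, E) (𝓘(ℝ, E).prod 𝓘(ℝ, V.F)) ∞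
      (fun y => TotalSpace.mk' V.F y (FiberBundle.extend V.F v y)) t.baseSet := by
    rw [t.contMDiffOn_section_baseSet_iff]
    apply (contMDiffOn_const (c := (t ⟨x, v⟩).2)).congr
    intro y hy
    simp [FiberBundle.extend, t, hy]
  obtain ⟨s, hs⟩ := exists_sec_germ t.open_baseSet hx h
  exact ⟨s, by simpa using hs.self_of_nhds⟩

/-- Near every point a section is a combination of finitely many global sections, the coefficients
being smooth functions that vanish at the point if the section does. -/
theorem sec_decomposition {V : VBundle.{uE, uM, w} E M} (x : M) (s : Sec V) (hs : s x = 0) :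
    ∃ (ψ : Fn E M) (n : ℕ) (f : Fin n → Fn E M) (t : Fin n → Sec V),
      ψ x = 1 ∧ (∀ i, f i x = 0) ∧ fmul ψ s = ∑ i, fmul (f i) (t i) := by
  let e := trivializationAt V.F V.fib x
  have hx : x ∈ e.baseSet := FiberBundle.mem_baseSet_trivializationAt' x
  let b := Module.finBasis ℝ V.F
  obtain ⟨ψ, h1, h2⟩ := exists_bump (E := E) (e.open_baseSet.mem_nhds hx)
  let c := e.localFrameCoeff 𝓘(ℝ, E) b
  have hc (i) : ContMDiffOn 𝓘(ℝ, E) 𝓘(ℝ, ℝ) ∞ (fun y => c i y (s y)) e.baseSet :=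
    contMDiffOn_baseSet_localFrameCoeff (b := b) s.contMDiff.contMDiffOn i
  have hf (i) : ContMDiff 𝓘(ℝ, E) 𝓘(ℝ, ℝ) ∞ (fun y => ψ y * c i y (s y)) := by
    refine contMDiff_of_tsupport fun y hy => ?_
    have hy' : y ∈ e.baseSet := h1 (closure_mono (Function.support_mul_subset_left ψ _) hy)
    exact (ψ.contMDiff y).mul ((hc i).contMDiffAt (e.open_baseSet.mem_nhds hy'))
  have ht (i) : ContMDiff 𝓘(ℝ, E) (𝓘(ℝ, E).prod 𝓘(ℝ, V.F)) ∞
      (fun y => TotalSpace.mk' V.F y (ψ y • e.localFrame b i y)) :=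
    ContMDiffOn.smul_section_of_tsupport (ψ := ψ) ψ.contMDiff.contMDiffOn e.open_baseSet h1
      (e.contMDiffOn_localFrame_baseSet _ b i)
  refine ⟨ψ * ψ, _, fun i => ⟨_, hf i⟩, fun i => ⟨_, ht i⟩, ?_, ?_, ?_⟩
  · simp [h2.self_of_nhds]
  · intro i
    change ψ x * c i x (s x) = 0
    simp [hs]
  · ext y
    have hsum : (∑ i, fmul (⟨_, hf i⟩ : Fn E M) (⟨_, ht i⟩ : Sec V)) y
        = ∑ i, (ψ y * c i y (s y)) • ψ y • e.localFrame b i y := by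
      have := map_sum (ContMDiffSection.coeAddHom 𝓘(ℝ, E) V.F ∞ V.fib)
        (fun i => fmul (⟨_, hf i⟩ : Fn E M) (⟨_, ht i⟩ : Sec V)) Finset.univ
      have := congrFun this y
      rw [Finset.sum_apply] at this
      exact this
    rw [hsum]
    change (ψ y * ψ y) • s y = _
    by_cases hy : y ∈ e.baseSet
    · have := e.eq_sum_localFrameCoeff_smul (I := 𝓘(ℝ, E)) (b := b) (s := s) hy
      conv_lhs => rw [this]
      rw [Finset.smul_sum]
      refine Finset.sum_congr rfl fun i _ => ?_
      rw [smul_smul, smul_smul]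
      congr 1
      change _ * c i y (s y) = _
      ring
    · have : ψ y = 0 := image_eq_zero_of_notMem_tsupport fun h => hy (h1 h)
      simp [this]

theorem exists_functional {V : VBundle.{uE, uM, w} E M} {x : M} {φ : Sec V → ℝ}
    (hadd : ∀ s t, φ (s + t) = φ s + φ t) (hmul : ∀ (f : Fn E M) s, φ (fmul f s) = f x * φ s) :
    ∃ l : V.fib x →L[ℝ] ℝ, ∀ s : Sec V, l (s x) = φ s := by
  let φ' : Sec V →+ ℝ := AddMonoidHom.mk' φ hadd
  have hzero (s : Sec V) (hs : s x = 0) : φ s = 0 := by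
    obtain ⟨ψ, n, f, t, h1, h2, h3⟩ := sec_decomposition x s hs
    have h4 : φ (fmul ψ s) = φ s := by rw [hmul, h1, one_mul]
    rw [← h4, h3]
    change φ' _ = 0
    rw [map_sum]
    refine Finset.sum_eq_zero fun i _ => ?_
    change φ _ = 0
    rw [hmul, h2, zero_mul]
  have hval (s t : Sec V) (h : s x = t x) : φ s = φ t := by
    have h5 : φ' (s - t) = 0 := hzero _ (by change s x - t x = 0; rw [h, sub_self])
    rw [map_sub] at h5
    exact sub_eq_zero.1 h5
  choose ext hext using fun v : V.fib x => exists_sec_apply (E := E) v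
  let l : V.fib x →ₗ[ℝ] ℝ :=
    { toFun := fun v => φ (ext v)
      map_add' := fun v v' => by
        rw [← hadd]
        exact hval _ _ (by change _ = ext v x + ext v' x; simp only [hext])
      map_smul' := fun r v => by
        have := hmul (ContMDiffMap.const r) (ext v)
        change _ = r * φ (ext v)
        rw [show r * φ (ext v) = φ (fmul (ContMDiffMap.const r) (ext v)) from this.symm]
        exact hval _ _ (by change _ = r • ext v x; simp only [hext]) }
  have : T2Space (V.fib x) := FiberBundle.t2Space V.F V.fib x
  have : FiniteDimensional ℝ (V.fib x) := VectorBundle.finiteDimensional ℝ V.F V.fib x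
  have : IsTopologicalAddGroup (V.fib x) :=
    (VectorBundle.continuousLinearEquivAt ℝ V.F V.fib x).toContinuousAddEquiv.isTopologicalAddGroup
  have : ContinuousSMul ℝ (V.fib x) :=
    (VectorBundle.continuousLinearEquivAt ℝ V.F V.fib x).continuousSMul
  exact ⟨LinearMap.toContinuousLinearMap l, fun s => hval _ _ (hext _)⟩

/-- A pointwise section of the dual bundle is smooth if its values on smooth sections are. -/
theorem contMDiff_dual {V : VBundle.{uE, uM, w} E M} (σ : ∀ x, V.dual.fib x)
    (hσ : ∀ s : Sec V, ContMDiff 𝓘(ℝ, E) 𝓘(ℝ, ℝ) ∞ (fun x => σ x (s x))) :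
    ContMDiff 𝓘(ℝ, E) (𝓘(ℝ, E).prod 𝓘(ℝ, V.dual.F)) ∞
      (fun x => TotalSpace.mk' V.dual.F x (σ x)) := by
  intro x
  let e := trivializationAt V.F V.fib x
  have hx : x ∈ e.baseSet := FiberBundle.mem_baseSet_trivializationAt' x
  let b := Module.finBasis ℝ V.F
  have hs (i) := exists_sec_germ e.open_baseSet hx (e.contMDiffOn_localFrame_baseSet ∞ b i)
  choose s hs using hs
  refine (contMDiffAt_hom_bundle (IB := 𝓘(ℝ, E)) (E₂ := Trivial M ℝ) _).2 ⟨contMDiffAt_id, ?_⟩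
  have hsm : ContMDiffAt 𝓘(ℝ, E) 𝓘(ℝ, V.F →L[ℝ] ℝ) ∞
      (fun y => ∑ i, (σ y (s i y) : ℝ) • LinearMap.toContinuousLinearMap (b.coord i)) x :=
    ContMDiffAt.sum fun i _ => (hσ (s i) x).smul contMDiffAt_const
  refine hsm.congr_of_eventuallyEq ?_
  filter_upwards [Filter.eventually_all.2 hs, e.open_baseSet.mem_nhds hx] with y hy hye
  apply ContinuousLinearMap.coe_injective
  refine b.ext fun j => ?_
  have h1 : (∑ i, (σ y (s i y) : ℝ) • LinearMap.toContinuousLinearMap (b.coord i)) (b j)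
      = σ y (s j y) := by
    rw [sum_apply]
    rw [Finset.sum_eq_single j]
    · simp
    · intro i _ hij
      simp [hij.symm]
    · simp
  refine Eq.trans ?_ h1.symm
  have hj : s j y = e.symm y (b j) := by
    rw [hy j, e.localFrame_apply_of_mem_baseSet _ hye]
    simp [Trivialization.basisAt]
  rw [hj]
  simp [ContinuousLinearMap.inCoordinates, e, Trivialization.symmL_apply _ hye]

/-- The section of the dual bundle given by a `C^∞(M)`-linear map from sections to functions. -/
def ofTensorial {V : VBundle.{uE, uM, w} E M} (φ : Sec V → Fn E M)
    (hadd : ∀ s t, φ (s + t) = φ s + φ t) (hmul : ∀ (f : Fn E M) s, φ (fmul f s) = f * φ s) :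
    Sec V.dual :=
  have h (x : M) := exists_functional (x := x) (φ := fun s => φ s x)
    (fun s t => by rw [hadd]; rfl) (fun f s => by rw [hmul]; rfl)
  ⟨fun x => (h x).choose, contMDiff_dual _ fun s =>
    (φ s).contMDiff.congr fun x => (h x).choose_spec s⟩

theorem evalSec_ofTensorial {V : VBundle.{uE, uM, w} E M} (φ : Sec V → Fn E M)
    (hadd : ∀ s t, φ (s + t) = φ s + φ t) (hmul : ∀ (f : Fn E M) s, φ (fmul f s) = f * φ s)
    (s : Sec V) : evalSec (ofTensorial φ hadd hmul) s = φ s := by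
  ext x
  exact (exists_functional (x := x) (φ := fun s => φ s x)
    (fun s t => by rw [hadd]; rfl) (fun f s => by rw [hmul]; rfl)).choose_spec s

end Tensorial

section Calculus

variable {E : Type uE} [NormedAddCommGroup E] [NormedSpace ℝ E] [FiniteDimensional ℝ E]
  {M : Type uM} [TopologicalSpace M] [ChartedSpace E M] [IsManifold 𝓘(ℝ, E) ∞ M]

/-- The derivative `X f` of a smooth function along a vector field. -/
def lieFn (X : Sec (tangent E M)) (f : Fn E M) : Fn E M :=
  ⟨fun x => mvfderiv 𝓘(ℝ, E) f x (X x), by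
    have h1 := f.contMDiff.contMDiff_tangentMap (m := ∞) le_rfl
    exact (contMDiff_snd_tangentBundle_modelSpace ℝ 𝓘(ℝ, ℝ)).comp (h1.comp X.contMDiff)⟩

/-- The Lie bracket of vector fields. -/
def vbr (X Y : Sec (tangent E M)) : Sec (tangent E M) :=
  ⟨VectorField.mlieBracket 𝓘(ℝ, E) X Y, fun x => by
    have : CompleteSpace E := FiniteDimensional.complete ℝ E
    have : IsManifold 𝓘(ℝ, E) ((⊤ : ℕ∞) + 1) M := ‹IsManifold 𝓘(ℝ, E) ∞ M›
    have : IsManifold 𝓘(ℝ, E) (minSmoothness ℝ 2) M := by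
      rw [minSmoothness_of_isRCLikeNormedField]; infer_instance
    exact ContMDiffAt.mlieBracket_vectorField (m := ⊤) (n := ⊤) (X.contMDiff x) (Y.contMDiff x)
      (by simp)⟩

theorem lieFn_add (X : Sec (tangent E M)) (f g : Fn E M) :
    lieFn X (f + g) = lieFn X f + lieFn X g := by
  ext x
  change mvfderiv 𝓘(ℝ, E) (f + g : M → ℝ) x (X x) = _
  rw [mvfderiv_add (fn_mdiff f x) (fn_mdiff g x)]
  rfl

theorem lieFn_sub (X : Sec (tangent E M)) (f g : Fn E M) :
    lieFn X (f - g) = lieFn X f - lieFn X g := by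
  ext x
  change mvfderiv 𝓘(ℝ, E) (f - g : M → ℝ) x (X x) = _
  rw [mvfderiv_sub (fn_mdiff f x) (fn_mdiff g x)]
  rfl

theorem lieFn_mul (X : Sec (tangent E M)) (f g : Fn E M) :
    lieFn X (f * g) = f * lieFn X g + lieFn X f * g := by
  ext x
  change mvfderiv 𝓘(ℝ, E) (f * g : M → ℝ) x (X x) =
    f x * mvfderiv 𝓘(ℝ, E) g x (X x) + mvfderiv 𝓘(ℝ, E) f x (X x) * g x
  rw [mvfderiv_mul (fn_mdiff f x) (fn_mdiff g x)]
  simp [mul_comm]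

theorem lieFn_add_left (X Y : Sec (tangent E M)) (f : Fn E M) :
    lieFn (X + Y) f = lieFn X f + lieFn Y f := by
  ext x
  exact map_add (mvfderiv 𝓘(ℝ, E) f x) (X x) (Y x)

theorem lieFn_fmul (g : Fn E M) (X : Sec (tangent E M)) (f : Fn E M) :
    lieFn (fmul g X) f = g * lieFn X f := by
  ext x
  exact map_smul (mvfderiv 𝓘(ℝ, E) f x) (g x) (X x)

theorem vbr_add (X Y Z : Sec (tangent E M)) : vbr X (Y + Z) = vbr X Y + vbr X Z := by
  have : CompleteSpace E := FiniteDimensional.complete ℝ E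
  ext x
  exact VectorField.mlieBracket_add_right Y.mdifferentiableAt Z.mdifferentiableAt

theorem vbr_fmul (X : Sec (tangent E M)) (f : Fn E M) (Y : Sec (tangent E M)) :
    vbr X (fmul f Y) = fmul f (vbr X Y) + fmul (lieFn X f) Y := by
  have : CompleteSpace E := FiniteDimensional.complete ℝ E
  ext x
  refine (VectorField.mlieBracket_smul_right (fn_mdiff f x) Y.mdifferentiableAt).trans ?_
  exact add_comm _ _

theorem vbr_skew (X Y : Sec (tangent E M)) : vbr X Y = -vbr Y X := by
  ext x
  exact VectorField.mlieBracket_swap_apply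

theorem vbr_jacobi (X Y Z : Sec (tangent E M)) :
    vbr X (vbr Y Z) = vbr (vbr X Y) Z + vbr Y (vbr X Z) := by
  have : CompleteSpace E := FiniteDimensional.complete ℝ E
  have : IsManifold 𝓘(ℝ, E) (minSmoothness ℝ 3) M :=
    by
    rw [minSmoothness_of_isRCLikeNormedField]; exact IsManifold.of_le (n := ∞) ENat.LEInfty.out
  have h (X : Sec (tangent E M)) :=
    X.contMDiff.of_le (m := minSmoothness ℝ 2) (by
      rw [minSmoothness_of_isRCLikeNormedField]; exact ENat.LEInfty.out)
  ext x
  exact VectorField.leibniz_identity_mlieBracket_apply (h X x) (h Y x) (h Z x)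

variable [T2Space M]

/-- The differential `df`. -/
def dFn (f : Fn E M) : Sec (tangent E M).dual :=
  ⟨fun x => mvfderiv 𝓘(ℝ, E) f x, contMDiff_dual _ fun X => (lieFn X f).contMDiff⟩

/-- The Lie derivative of a one-form: `(L_X θ)(Y) = X (θ Y) - θ [X, Y]`. -/
def lieForm (X : Sec (tangent E M)) (θ : Sec (tangent E M).dual) : Sec (tangent E M).dual :=
  ofTensorial (fun Y => lieFn X (evalSec θ Y) - evalSec θ (vbr X Y))
    (fun Y Z => by rw [evalSec_add, lieFn_add, vbr_add, evalSec_add]; ring)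
    (fun f Y => by
      rw [evalSec_fmul, lieFn_mul, vbr_fmul, evalSec_add, evalSec_fmul, evalSec_fmul]; ring)

/-- The contraction `i_X dθ`, where `dθ(X, Y) = X (θ Y) - Y (θ X) - θ [X, Y]`. -/
def contrD (X : Sec (tangent E M)) (θ : Sec (tangent E M).dual) : Sec (tangent E M).dual :=
  ofTensorial (fun Y => lieFn X (evalSec θ Y) - lieFn Y (evalSec θ X) - evalSec θ (vbr X Y))
    (fun Y Z => by
      rw [evalSec_add, lieFn_add, lieFn_add_left, vbr_add, evalSec_add]; ring)
    (fun f Y => by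
      rw [evalSec_fmul, lieFn_mul, lieFn_fmul, vbr_fmul, evalSec_add, evalSec_fmul, evalSec_fmul]
      ring)

end Calculus

section Algebroids

variable {E : Type uE} [NormedAddCommGroup E] [NormedSpace ℝ E] [FiniteDimensional ℝ E]
  {M : Type uM} [TopologicalSpace M] [ChartedSpace E M] [IsManifold 𝓘(ℝ, E) ∞ M]

/-- Lie algebroids over `M`. -/
structure LieAlgebroid (A : VBundle.{uE, uM, w} E M) where
  anchor : VBHom A (tangent E M)
  bracket : Sec A → Sec A → Sec A
  bilinear : IsBilinearMap ℝ bracket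
  skew : ∀ a b, bracket a b = -bracket b a
  jacobi : ∀ a b c, bracket a (bracket b c) = bracket (bracket a b) c + bracket b (bracket a c)
  leibniz : ∀ a (f : Fn E M) b,
    bracket a (fmul f b) = fmul f (bracket a b) + fmul (lieFn (anchor.map a) f) b
  anchor_bracket : ∀ a b, anchor.map (bracket a b) = vbr (anchor.map a) (anchor.map b)

/-- The data of a (possibly degenerate) Courant algebroid: an anchor, a smooth fibrewise bilinear
form and a bracket on sections. -/
structure CourantData (C : VBundle.{uE, uM, w} E M) where
  anchor : VBHom C (tangent E M)
  pairing : ∀ x, LinearMap.BilinForm ℝ (C.fib x)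
  smooth_pairing : ∀ s t : Sec C,
    ContMDiff 𝓘(ℝ, E) 𝓘(ℝ, ℝ) ∞ (fun x => pairing x (s x) (t x))
  bracket : Sec C → Sec C → Sec C

/-- The smooth function `⟨s, t⟩`. -/
def CourantData.pair {C : VBundle.{uE, uM, w} E M} (c : CourantData C) (s t : Sec C) : Fn E M :=
  ⟨_, c.smooth_pairing s t⟩

/-- Courant algebroids. In `symm_part`, the identity `⟦s, t⟧ + ⟦t, s⟧ = 𝒟⟨s, t⟩` is paired with an
arbitrary section `r`, where `⟨𝒟 f, r⟩ = ρ(r) f` defines `𝒟`. -/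
structure IsCourant {C : VBundle.{uE, uM, w} E M} (c : CourantData C) : Prop where
  symm : ∀ x v v', c.pairing x v v' = c.pairing x v' v
  nondegenerate : ∀ x v, (∀ v', c.pairing x v v' = 0) → v = 0
  bilinear : IsBilinearMap ℝ c.bracket
  jacobi : ∀ s t r, c.bracket s (c.bracket t r)
    = c.bracket (c.bracket s t) r + c.bracket t (c.bracket s r)
  invariant : ∀ s t r, lieFn (c.anchor.map s) (c.pair t r)
    = c.pair (c.bracket s t) r + c.pair t (c.bracket s r)
  symm_part : ∀ s t r, c.pair (c.bracket s t + c.bracket t s) r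
    = lieFn (c.anchor.map r) (c.pair s t)

/-- (Degenerate) Courant morphisms. -/
structure IsCourantMorphism {C : VBundle.{uE, uM, w₁} E M} {D : VBundle.{uE, uM, w₂} E M}
    (c : CourantData C) (d : CourantData D) (Φ : VBHom C D) : Prop where
  anchor : ∀ x v, d.anchor.app x (Φ.app x v) = c.anchor.app x v
  pairing : ∀ x v v', d.pairing x (Φ.app x v) (Φ.app x v') = c.pairing x v v'
  bracket : ∀ s t, Φ.map (c.bracket s t) = d.bracket (Φ.map s) (Φ.map t)

variable {A : VBundle.{uE, uM, w} E M}

/-- The bundle `TM ⊕ A*`. -/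
abbrev VBundle.Q (A : VBundle.{uE, uM, w} E M) : VBundle.{uE, uM, max uE w} E M :=
  (tangent E M).prod A.dual

/-- The bundle `A ⊕ T*M`. -/
abbrev VBundle.B (A : VBundle.{uE, uM, w} E M) : VBundle.{uE, uM, max w uE} E M :=
  A.prod (tangent E M).dual

/-- The fibrewise pairing `⟨(X, α), (a, θ)⟩ = α(a) + θ(X)` of `TM ⊕ A*` with `A ⊕ T*M`. -/
def dualPair (x : M) (ν : A.Q.fib x) (τ : A.B.fib x) : ℝ := ν.2 τ.1 + τ.2 ν.1

/-- The smooth function `⟨ν, τ⟩` for sections `ν` of `TM ⊕ A*` and `τ` of `A ⊕ T*M`. -/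
def dualPairFn (ν : Sec A.Q) (τ : Sec A.B) : Fn E M :=
  evalSec ν.snd τ.fst + evalSec τ.snd ν.fst

theorem anchor_fmul (φ : VBHom A (tangent E M)) (f : Fn E M) (a : Sec A) :
    φ.map (fmul f a) = fmul f (φ.map a) := by
  ext x
  exact map_smul (φ.app x) (f x) (a x)

variable [T2Space M]

/-- Two vectors on which all smooth functions have the same derivative agree. -/
theorem tangent_ext {x : M} (v v' : (tangent E M).fib x)
    (h : ∀ f : Fn E M, mvfderiv 𝓘(ℝ, E) f x v = mvfderiv 𝓘(ℝ, E) f x v') : v = v' := by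
  have hinv : (mfderiv 𝓘(ℝ, E) 𝓘(ℝ, E) (extChartAt 𝓘(ℝ, E) x) x).IsInvertible :=
    isInvertible_mfderiv_extChartAt (mem_extChartAt_source x)
  refine hinv.injective ?_
  refine (SeparatingDual.eq_iff_forall_dual_eq (R := ℝ) (V := E)).2 fun l => ?_
  have hsm : ContMDiffOn 𝓘(ℝ, E) 𝓘(ℝ, ℝ) ∞ (fun y => l (extChartAt 𝓘(ℝ, E) x y))
      (chartAt E x).source :=
    l.contMDiff.comp_contMDiffOn contMDiffOn_extChartAt
  obtain ⟨ψ, h1, h2⟩ := exists_bump (E := E) ((chartAt E x).open_source.mem_nhds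
    (mem_chart_source E x))
  let f : Fn E M := ⟨fun y => ψ y * l (extChartAt 𝓘(ℝ, E) x y), by
    refine contMDiff_of_tsupport fun y hy => ?_
    have hy' := h1 (closure_mono (Function.support_mul_subset_left ψ _) hy)
    exact (ψ.contMDiff y).mul (hsm.contMDiffAt ((chartAt E x).open_source.mem_nhds hy'))⟩
  have hf : (f : M → ℝ) =ᶠ[nhds x] l ∘ extChartAt 𝓘(ℝ, E) x := by
    filter_upwards [h2] with y hy
    change ψ y * l (extChartAt 𝓘(ℝ, E) x y) = l (extChartAt 𝓘(ℝ, E) x y)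
    rw [hy, one_mul]
  have hd (v : TangentSpace 𝓘(ℝ, E) x) : mvfderiv 𝓘(ℝ, E) f x v
      = l (mfderiv 𝓘(ℝ, E) 𝓘(ℝ, E) (extChartAt 𝓘(ℝ, E) x) x v) := by
    have h3 : mfderiv 𝓘(ℝ, E) 𝓘(ℝ, ℝ) f x
        = mfderiv 𝓘(ℝ, E) 𝓘(ℝ, ℝ) (l ∘ extChartAt 𝓘(ℝ, E) x) x := hf.mfderiv_eq
    have h4 := mfderiv_comp (I := 𝓘(ℝ, E)) (I' := 𝓘(ℝ, E)) (I'' := 𝓘(ℝ, ℝ)) x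
      l.mdifferentiableAt (mdifferentiableAt_extChartAt (mem_chart_source E x))
    change mfderiv 𝓘(ℝ, E) 𝓘(ℝ, ℝ) f x v = _
    rw [h3, h4, ContinuousLinearMap.mfderiv_eq]
    rfl
  have := h f
  rw [hd, hd] at this
  exact this

theorem lieFn_vbr (X Y : Sec (tangent E M)) (f : Fn E M) :
    lieFn (vbr X Y) f = lieFn X (lieFn Y f) - lieFn Y (lieFn X f) := by
  ext x
  have h (Z : Sec (tangent E M)) :
      fmul (lieFn (vbr X Y) f) Z + fmul (lieFn Y (lieFn X f)) Z
        = fmul (lieFn X (lieFn Y f)) Z := by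
    have := vbr_jacobi X Y (fmul f Z)
    simp only [vbr_fmul, vbr_add] at this
    rw [vbr_jacobi X Y Z] at this
    simp only [fmul_add] at this
    have h2 := sub_eq_zero.2 this
    rw [← sub_eq_zero, ← neg_eq_zero]
    rw [← h2]
    abel
  by_cases hx : Subsingleton E
  · have h0 (v : TangentSpace 𝓘(ℝ, E) x) : v = 0 := Subsingleton.elim (α := E) v 0
    have h1 (Z : Sec (tangent E M)) (g : Fn E M) : lieFn Z g x = 0 := by
      change mvfderiv 𝓘(ℝ, E) g x (Z x) = 0
      rw [h0 (Z x), map_zero]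
    change _ = lieFn X (lieFn Y f) x - lieFn Y (lieFn X f) x
    simp only [h1, sub_zero]
  · rw [not_subsingleton_iff_nontrivial] at hx
    obtain ⟨v, hv⟩ := exists_ne (0 : E)
    obtain ⟨Z, hZ⟩ := exists_sec_apply (E := E) (V := tangent E M) (x := x) v
    have h2 : lieFn (vbr X Y) f x • Z x + lieFn Y (lieFn X f) x • Z x
      = lieFn X (lieFn Y f) x • Z x := congrArg (fun s : Sec (tangent E M) => s x) (h Z)
    rw [← add_smul, hZ] at h2
    have h3 := smul_left_injective ℝ hv h2
    change _ = lieFn X (lieFn Y f) x - lieFn Y (lieFn X f) x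
    linarith

namespace IsCourant

variable {C : VBundle.{uE, uM, w} E M} {c : CourantData C}

theorem sec_ext (hc : IsCourant c) {s t : Sec C} (h : ∀ r, c.pair s r = c.pair t r) : s = t := by
  ext x
  refine sub_eq_zero.1 (hc.nondegenerate x _ fun v => ?_)
  obtain ⟨r, rfl⟩ := exists_sec_apply (E := E) v
  have := congrArg (fun f : Fn E M => f x) (h r)
  change c.pairing x (s x) (r x) = c.pairing x (t x) (r x) at this
  rw [map_sub, LinearMap.sub_apply, this, sub_self]

theorem leibniz (hc : IsCourant c) (s : Sec C) (f : Fn E M) (t : Sec C) :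
    c.bracket s (fmul f t) = fmul f (c.bracket s t) + fmul (lieFn (c.anchor.map s) f) t := by
  refine hc.sec_ext fun r => ?_
  have h1 (g : Fn E M) (a b : Sec C) : c.pair (fmul g a) b = g * c.pair a b := by
    ext x
    change c.pairing x (g x • a x) (b x) = g x * c.pairing x (a x) (b x)
    simp
  have h2 (a b d : Sec C) : c.pair (a + b) d = c.pair a d + c.pair b d := by
    ext x
    change c.pairing x (a x + b x) (d x) = c.pairing x (a x) (d x) + c.pairing x (b x) (d x)
    simp
  have h3 := hc.invariant s (fmul f t) r
  have h4 := hc.invariant s t r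
  rw [h1, h1, lieFn_mul, h4] at h3
  rw [h2, h1, h1]
  linear_combination -h3

theorem anchor_bracket (hc : IsCourant c) (s t : Sec C) :
    c.anchor.map (c.bracket s t) = vbr (c.anchor.map s) (c.anchor.map t) := by
  have h (f : Fn E M) (r : Sec C) :
      fmul (lieFn (c.anchor.map (c.bracket s t)) f) r
        = fmul (lieFn (vbr (c.anchor.map s) (c.anchor.map t)) f) r := by
    have h1 := hc.jacobi s t (fmul f r)
    have hadd (a b d : Sec C) : c.bracket a (b + d) = c.bracket a b + c.bracket a d :=
      hc.bilinear.add_right a b d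
    simp only [hc.leibniz, hadd] at h1
    rw [hc.jacobi s t r] at h1
    simp only [fmul_add] at h1
    rw [lieFn_vbr]
    have h5 : lieFn (c.anchor.map s) (lieFn (c.anchor.map t) f)
      - lieFn (c.anchor.map t) (lieFn (c.anchor.map s) f)
      + lieFn (c.anchor.map t) (lieFn (c.anchor.map s) f)
      = lieFn (c.anchor.map s) (lieFn (c.anchor.map t) f) := by ring
    have h6 := add_fmul (lieFn (c.anchor.map s) (lieFn (c.anchor.map t) f)
      - lieFn (c.anchor.map t) (lieFn (c.anchor.map s) f))
      (lieFn (c.anchor.map t) (lieFn (c.anchor.map s) f)) r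
    rw [h5] at h6
    rw [h6] at h1
    have h7 := sub_eq_zero.2 h1
    rw [← sub_eq_zero, ← neg_eq_zero, ← h7]
    abel
  ext x
  by_cases hx : Subsingleton (C.fib x)
  · have hsub (y : M) : Subsingleton (C.fib y) :=
      (VectorBundle.continuousLinearEquivAt ℝ C.F C.fib y).toEquiv.subsingleton_congr.2
        ((VectorBundle.continuousLinearEquivAt ℝ C.F C.fib x).toEquiv.subsingleton_congr.1 hx)
    have h0 (s : Sec C) : c.anchor.map s = 0 := by
      ext y
      change c.anchor.app y (s y) = 0
      rw [Subsingleton.elim (s y) 0, map_zero]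
    rw [h0, h0, h0]
    exact (congrFun (VectorField.mlieBracket_zero_left (I := 𝓘(ℝ, E)) (M := M) (W := 0)) x).symm
  · rw [not_subsingleton_iff_nontrivial] at hx
    obtain ⟨v, hv⟩ := exists_ne (0 : C.fib x)
    obtain ⟨r, rfl⟩ := exists_sec_apply (E := E) v
    refine tangent_ext _ _ fun f => ?_
    exact smul_left_injective ℝ hv (congrArg (fun s : Sec C => s x) (h f r))

end IsCourant

namespace LieAlgebroid

/-- The dual Lie derivative: `(L_a α)(b) = ρ(a) (α b) - α [a, b]`. -/
def lieDual (LA : LieAlgebroid A) (a : Sec A) (α : Sec A.dual) : Sec A.dual :=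
  ofTensorial (fun b => lieFn (LA.anchor.map a) (evalSec α b) - evalSec α (LA.bracket a b))
    (fun b b' => by
      rw [evalSec_add, lieFn_add, LA.bilinear.add_right, evalSec_add]; ring)
    (fun f b => by
      rw [evalSec_fmul, lieFn_mul, LA.leibniz, evalSec_add, evalSec_fmul, evalSec_fmul]; ring)

/-- The Lie derivative `L_a (X, α) = ([ρ(a), X], L_a α)` on sections of `TM ⊕ A*`. -/
def lieQ (LA : LieAlgebroid A) (a : Sec A) (ν : Sec A.Q) : Sec A.Q :=
  pairSec (vbr (LA.anchor.map a) ν.fst) (LA.lieDual a ν.snd)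

/-- The fibrewise map `(ρ, ρᵗ) : A ⊕ T*M → TM ⊕ A*`. -/
def rr (LA : LieAlgebroid A) (x : M) : A.B.fib x →ₗ[ℝ] A.Q.fib x where
  toFun τ := (LA.anchor.app x τ.1, τ.2.comp (LA.anchor.app x))
  map_add' _ _ := Prod.ext (map_add _ _ _) (ContinuousLinearMap.add_comp _ _ _)
  map_smul' _ _ := Prod.ext (map_smul _ _ _) (ContinuousLinearMap.smul_comp _ _ _)

/-- The map `(ρ, ρᵗ)` on sections. -/
def rrSec (LA : LieAlgebroid A) (τ : Sec A.B) : Sec A.Q :=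
  pairSec (LA.anchor.map τ.fst)
    ⟨fun x => (τ x).2.comp (LA.anchor.app x), contMDiff_dual _ fun a =>
      (evalSec τ.snd (LA.anchor.map a)).contMDiff⟩

/-- The degenerate Courant algebroid structure on `A ⊕ T*M`, with anchor `ρ ∘ pr_A`, pairing
`⟨(a, θ), (a', θ')⟩ = θ'(ρ a) + θ(ρ a')` and bracket
`[(a, θ), (a', θ')] = ([a, a'], L_{ρ a} θ' - i_{ρ a'} dθ)`. -/
def degenerate (LA : LieAlgebroid A) : CourantData A.B where
  anchor :=
    { app := fun x => (LA.anchor.app x).comp (ContinuousLinearMap.fst ℝ _ _)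
      smooth_app := by
        have hfst : ContMDiff (𝓘(ℝ, E).prod 𝓘(ℝ, A.B.F)) (𝓘(ℝ, E).prod 𝓘(ℝ, A.F)) ∞
            (fun p : TotalSpace A.B.F A.B.fib => (⟨p.1, p.2.1⟩ : TotalSpace A.F A.fib)) := by
          intro p
          have h := contMDiffAt_totalSpace.1
            (contMDiffAt_id (I := 𝓘(ℝ, E).prod 𝓘(ℝ, A.B.F)) (n := ∞) (x := p))
          refine contMDiffAt_totalSpace.2 ⟨h.1, ?_⟩
          exact (ContinuousLinearMap.fst ℝ A.F (E →L[ℝ] ℝ)).contMDiff.contMDiffAt.comp p h.2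
        exact LA.anchor.smooth_app.comp hfst }
  pairing x := LinearMap.mk₂ ℝ
    (fun τ τ' => (τ'.2 (LA.anchor.app x τ.1) + τ.2 (LA.anchor.app x τ'.1) : ℝ))
    (fun τ₁ τ₂ τ' => by
      change (τ'.2 (LA.anchor.app x (τ₁.1 + τ₂.1)) : ℝ)
        + ((τ₁.2 (LA.anchor.app x τ'.1) : ℝ) + (τ₂.2 (LA.anchor.app x τ'.1) : ℝ)) = _
      rw [map_add, map_add]
      exact add_add_add_comm _ _ _ _)
    (fun r τ τ' => by
      change (τ'.2 (LA.anchor.app x (r • τ.1)) : ℝ) + r * (τ.2 (LA.anchor.app x τ'.1) : ℝ) = _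
      rw [map_smul, map_smul]
      exact (mul_add r _ _).symm)
    (fun τ τ₁ τ₂ => by
      change ((τ₁.2 (LA.anchor.app x τ.1) : ℝ) + (τ₂.2 (LA.anchor.app x τ.1) : ℝ))
        + (τ.2 (LA.anchor.app x (τ₁.1 + τ₂.1)) : ℝ) = _
      rw [map_add, map_add]
      exact add_add_add_comm _ _ _ _)
    (fun r τ τ' => by
      change r * (τ'.2 (LA.anchor.app x τ.1) : ℝ) + (τ.2 (LA.anchor.app x (r • τ'.1)) : ℝ) = _
      rw [map_smul, map_smul]
      exact (mul_add r _ _).symm)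
  smooth_pairing τ τ' := (evalSec τ'.snd (LA.anchor.map τ.fst)
    + evalSec τ.snd (LA.anchor.map τ'.fst)).contMDiff
  bracket τ τ' := pairSec (LA.bracket τ.fst τ'.fst)
    (lieForm (LA.anchor.map τ.fst) τ'.snd - contrD (LA.anchor.map τ'.fst) τ.snd)

end LieAlgebroid

/-- A Lie algebroid `U` with an injective bundle morphism `ι : U → TM ⊕ A*` that is compatible with
the anchors. -/
structure LieTriple (A : VBundle.{uE, uM, w} E M) where
  U : VBundle.{uE, uM, w₁} E M
  lie : LieAlgebroid U
  ι : VBHom U A.Q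
  ι_injective : ∀ x, Function.Injective (ι.app x)
  ι_anchor : ∀ x u, (ι.app x u).1 = lie.anchor.app x u

/-- `A`-Manin pairs `(C, U)` with structure maps `ι`, `Φ`. The subbundle `U` of `C` is given by a
vector bundle with an injective morphism `incl : U → C`. -/
structure ManinPair (LA : LieAlgebroid A) where
  C : VBundle.{uE, uM, w₁} E M
  courant : CourantData C
  isCourant : IsCourant courant
  U : VBundle.{uE, uM, w₁} E M
  incl : VBHom U C
  incl_injective : ∀ x, Function.Injective (incl.app x)
  lagrangian : ∀ x v, (∀ u, courant.pairing x v (incl.app x u) = 0) ↔ ∃ u, incl.app x u = v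
  involutive : ∀ u v : Sec U, ∃ r : Sec U,
    incl.map r = courant.bracket (incl.map u) (incl.map v)
  ι : VBHom U A.Q
  ι_injective : ∀ x, Function.Injective (ι.app x)
  ι_anchor : ∀ x u, (ι.app x u).1 = courant.anchor.app x (incl.app x u)
  Φ : VBHom A.B C
  Φ_morphism : IsCourantMorphism LA.degenerate courant Φ
  Φ_spans : ∀ x v, ∃ u τ, v = incl.app x u + Φ.app x τ
  Φ_compat : ∀ x u τ, courant.pairing x (incl.app x u) (Φ.app x τ) = dualPair x (ι.app x u) τ

namespace ManinPair

variable {LA : LieAlgebroid A} (P : ManinPair.{uE, uM, w, w₁} LA)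

/-- The anchor `ρ_U` of the Dirac structure. -/
def anchorU : VBHom P.U (tangent E M) where
  app x := (P.courant.anchor.app x).comp (P.incl.app x)
  smooth_app := P.courant.anchor.smooth_app.comp P.incl.smooth_app

/-- The bracket of sections of the Dirac structure. -/
def bracketU (u v : Sec P.U) : Sec P.U := (P.involutive u v).choose

theorem incl_bracketU (u v : Sec P.U) :
    P.incl.map (P.bracketU u v) = P.courant.bracket (P.incl.map u) (P.incl.map v) :=
  (P.involutive u v).choose_spec

theorem incl_map_injective {u v : Sec P.U} (h : P.incl.map u = P.incl.map v) : u = v := by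
  ext x
  exact P.incl_injective x (congrArg (fun s : Sec P.C => s x) h)

theorem incl_add (u v : Sec P.U) : P.incl.map (u + v) = P.incl.map u + P.incl.map v := by
  ext x
  exact map_add (P.incl.app x) _ _

theorem incl_neg (u : Sec P.U) : P.incl.map (-u) = -P.incl.map u := by
  ext x
  exact map_neg (P.incl.app x) _

theorem incl_smul (r : ℝ) (u : Sec P.U) : P.incl.map (r • u) = r • P.incl.map u := by
  ext x
  exact map_smul (P.incl.app x) _ _

theorem incl_fmul (f : Fn E M) (u : Sec P.U) : P.incl.map (fmul f u) = fmul f (P.incl.map u) := by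
  ext x
  exact map_smul (P.incl.app x) _ _

/-- The Lie algebroid structure of the Dirac structure. -/
def lieU : LieAlgebroid P.U where
  anchor := P.anchorU
  bracket := P.bracketU
  bilinear :=
    { add_left := fun u u' v => P.incl_map_injective (by
        simp only [incl_bracketU, incl_add, P.isCourant.bilinear.add_left])
      smul_left := fun r u v => P.incl_map_injective (by
        simp only [incl_bracketU, incl_smul, P.isCourant.bilinear.smul_left])
      add_right := fun u v v' => P.incl_map_injective (by
        simp only [incl_bracketU, incl_add, P.isCourant.bilinear.add_right])
      smul_right := fun r u v => P.incl_map_injective (by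
        simp only [incl_bracketU, incl_smul, P.isCourant.bilinear.smul_right]) }
  skew u v := P.incl_map_injective (by
    rw [incl_neg, incl_bracketU, incl_bracketU, ← add_eq_zero_iff_eq_neg]
    refine P.isCourant.sec_ext fun r => ?_
    rw [P.isCourant.symm_part]
    have h : P.courant.pair (P.incl.map u) (P.incl.map v) = 0 := by
      ext x
      exact (P.lagrangian x _).2 ⟨u x, rfl⟩ (v x)
    rw [h]
    ext x
    change mvfderiv 𝓘(ℝ, E) (fun _ : M => (0 : ℝ)) x _ = P.courant.pairing x 0 (r x)
    rw [mvfderiv_const]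
    simp)
  jacobi u v r := P.incl_map_injective (by
    simp only [incl_bracketU, incl_add]
    exact P.isCourant.jacobi _ _ _)
  leibniz u f v := P.incl_map_injective (by
    simp only [incl_bracketU, incl_add, incl_fmul]
    exact P.isCourant.leibniz _ _ _)
  anchor_bracket u v := by
    have h (u : Sec P.U) : P.anchorU.map u = P.courant.anchor.map (P.incl.map u) := rfl
    rw [h, h, h, incl_bracketU]
    exact P.isCourant.anchor_bracket _ _

/-- The triple `(A, U, ι)` of an `A`-Manin pair. -/
def toLieTriple : LieTriple.{uE, uM, w, w₁} A where
  U := P.U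
  lie := P.lieU
  ι := P.ι
  ι_injective := P.ι_injective
  ι_anchor := P.ι_anchor

/-- The section `u ⊕ τ = u + Φ(τ)` of `C`. -/
def oplus (u : Sec P.U) (τ : Sec A.B) : Sec P.C := P.incl.map u + P.Φ.map τ

end ManinPair

/-- Dirac bialgebroids over `A`. -/
structure DiracBialgebroid (LA : LieAlgebroid A) extends LieTriple.{uE, uM, w, w₁} A where
  exists_maninPair : ∃ P : ManinPair.{uE, uM, w, w₁} LA, P.toLieTriple = toLieTriple

/-- The Dirac bialgebroid of an `A`-Manin pair. -/
def ManinPair.toDirac {LA : LieAlgebroid A} (P : ManinPair.{uE, uM, w, w₁} LA) :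
    DiracBialgebroid.{uE, uM, w, w₁} LA :=
  ⟨P.toLieTriple, P, rfl⟩

/-- The Lie algebroid `ι(U)` inside `TM ⊕ A*`: its fibres, and the graph of its bracket. -/
def LieTriple.image (T : LieTriple.{uE, uM, w, w₁} A) :
    (∀ x, Submodule ℝ (A.Q.fib x)) × Set (Sec A.Q × Sec A.Q × Sec A.Q) :=
  (fun x => LinearMap.range (T.ι.app x : T.U.fib x →ₗ[ℝ] A.Q.fib x),
   {p | ∃ u v : Sec T.U, p = (T.ι.map u, T.ι.map v, T.ι.map (T.lie.bracket u v))})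

/-- Equivalence of `A`-Manin pairs: they define the same Lie algebroid `ι(U)`. -/
def maninSetoid (LA : LieAlgebroid A) : Setoid (ManinPair.{uE, uM, w, w₁} LA) :=
  Setoid.ker fun P => P.toLieTriple.image

/-- Equivalence of Dirac bialgebroids: they define the same Lie algebroid `ι(U)`. -/
def diracSetoid (LA : LieAlgebroid A) : Setoid (DiracBialgebroid.{uE, uM, w, w₁} LA) :=
  Setoid.ker fun D => D.toLieTriple.image

/-- The map on equivalence classes sending the class of `(C, U)` to the class of `(A, U, ι)`. -/
def classMap (LA : LieAlgebroid A) :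
    Quotient (maninSetoid.{uE, uM, w, w₁} LA) → Quotient (diracSetoid.{uE, uM, w, w₁} LA) :=
  Quotient.map' ManinPair.toDirac fun _ _ h => h

namespace LieTriple

/-- The annihilator `U° ⊆ A ⊕ T*M` of `ι(U)`. -/
def ann (T : LieTriple.{uE, uM, w, w₁} A) (x : M) : Submodule ℝ (A.B.fib x) where
  carrier := {τ | ∀ u, dualPair x (T.ι.app x u) τ = 0}
  zero_mem' u := by
    change ((T.ι.app x u).2 0 : ℝ) + 0 = 0
    rw [map_zero]
    exact add_zero _
  add_mem' {τ τ'} h h' u := by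
    have e := congrArg₂ (· + ·) (h u) (h' u)
    change ((T.ι.app x u).2 (τ.1 + τ'.1) : ℝ)
      + ((τ.2 (T.ι.app x u).1 : ℝ) + (τ'.2 (T.ι.app x u).1 : ℝ)) = 0
    rw [map_add]
    refine (add_add_add_comm _ _ _ _).trans (e.trans (add_zero 0))
  smul_mem' r τ h u := by
    have e := congrArg (r * ·) (h u)
    change ((T.ι.app x u).2 (r • τ.1) : ℝ) + r * (τ.2 (T.ι.app x u).1 : ℝ) = 0
    rw [map_smul]
    exact (mul_add r _ _).symm.trans (e.trans (mul_zero r))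

/-- The graph of `-(ρ, ρᵗ) : U° → U`, with `U` identified with `ι(U)`. -/
def graph (LA : LieAlgebroid A) (T : LieTriple.{uE, uM, w, w₁} A) (x : M) :
    Submodule ℝ (T.U.fib x × A.B.fib x) where
  carrier := {p | p.2 ∈ T.ann x ∧ T.ι.app x p.1 = -LA.rr x p.2}
  zero_mem' := ⟨(T.ann x).zero_mem, by
    change T.ι.app x 0 = -LA.rr x 0
    rw [map_zero, map_zero, neg_zero]⟩
  add_mem' {p p'} h h' := ⟨(T.ann x).add_mem h.1 h'.1, by
    change T.ι.app x (p.1 + p'.1) = -LA.rr x (p.2 + p'.2)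
    rw [map_add, map_add, h.2, h'.2, neg_add]⟩
  smul_mem' r p h := ⟨(T.ann x).smul_mem r h.1, by
    change T.ι.app x (r • p.1) = -LA.rr x (r • p.2)
    rw [map_smul, map_smul, h.2, smul_neg]⟩

end LieTriple

/-- Dorfman `(TM ⊕ A*)`-connections on `A ⊕ T*M`. -/
structure DorfmanConnection (A : VBundle.{uE, uM, w} E M) where
  D : Sec A.Q → Sec A.B → Sec A.B
  bilinear : IsBilinearMap ℝ D
  derivation : ∀ ν (f : Fn E M) τ, D ν (fmul f τ) = fmul f (D ν τ) + fmul (lieFn ν.fst f) τ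
  fmul_left : ∀ (f : Fn E M) ν τ,
    D (fmul f ν) τ = fmul f (D ν τ) + fmul (dualPairFn ν τ) (pairSec 0 (dFn f))
  differential : ∀ ν (f : Fn E M), D ν (pairSec 0 (dFn f)) = pairSec 0 (dFn (lieFn ν.fst f))

/-- `Δ` extends the Lie derivative `L^U`: the bracket on `Γ(TM ⊕ A*)` dual to `Δ` restricts to the
bracket of `Γ(U)`. -/
def DorfmanConnection.Extends (Δ : DorfmanConnection A) (T : LieTriple.{uE, uM, w, w₁} A) : Prop :=
  ∀ (u v : Sec T.U) (τ : Sec A.B), dualPairFn (T.ι.map v) (Δ.D (T.ι.map u) τ)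
    = lieFn (T.lie.anchor.map u) (dualPairFn (T.ι.map v) τ)
      - dualPairFn (T.ι.map (T.lie.bracket u v)) τ

/-- The basic connection
`∇ᵇᵃˢ_a ν = (ρ, ρᵗ) (Δ_ν (a, 0) - (0, d⟨ν, (a, 0)⟩)) + L_a ν`. -/
def nablaBas (LA : LieAlgebroid A) (Δ : DorfmanConnection A) (a : Sec A) (ν : Sec A.Q) :
    Sec A.Q :=
  LA.rrSec (Δ.D ν (pairSec a 0) - pairSec 0 (dFn (dualPairFn ν (pairSec a 0)))) + LA.lieQ a ν

/-- Isomorphisms of `A`-Manin pairs with their structure maps. -/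
structure ManinIso {LA : LieAlgebroid A} (P : ManinPair.{uE, uM, w, w₁} LA)
    (P' : ManinPair.{uE, uM, w, w₂} LA) where
  Θ : VBHom P.C P'.C
  Θ_bijective : ∀ x, Function.Bijective (Θ.app x)
  Θ_courant : IsCourantMorphism P.courant P'.courant Θ
  ψ : VBHom P.U P'.U
  ψ_bijective : ∀ x, Function.Bijective (ψ.app x)
  Θ_incl : ∀ x u, Θ.app x (P.incl.app x u) = P'.incl.app x (ψ.app x u)
  ψ_ι : ∀ x u, P'.ι.app x (ψ.app x u) = P.ι.app x u
  Θ_Φ : ∀ x τ, Θ.app x (P.Φ.app x τ) = P'.Φ.app x τ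

end Algebroids

end DiracManin

end

open DiracManin

/-! Everything rests on the surjection `sumMap`, `(u, τ) ↦ u + Φ(τ)`, from `U ⊕ A ⊕ T*M` onto `C`.
Its anchor and pairing are forced: `U` is isotropic, `⟨u, Φ(τ)⟩` is prescribed by the compatibility
condition, and `Φ` preserves pairings. Since `U` is its own orthogonal, `Φ(τ) ∈ U` exactly on `U°`.
Pairing such a `Φ(τ)` with every `Φ(τ')` shows that its image under `ι` is `(ρ, ρᵗ)τ`, so the kernel
is the stated graph (`ker_sumMap`).

Only the mixed bracket remains (`exists_bracket_incl_Φ`). If `Δ` extends `L^U`, invariance of the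
pairing makes `Φ(Δ_u τ) - ⟦u, Φ(τ)⟧` orthogonal to `U`, hence a section of `U`. Pairing it with
`Φ(τ')` identifies it as the basic connection, by the identity `dualPairFn_nablaBas_sub` on `A ⊕
T*M`. The opposite order follows from the symmetric part of the bracket.

An extension `Δ` exists because a linear connection on `A*` yields some dull bracket on `TM ⊕ A*`.
On `ι(U)` it differs from the bracket of `U` by a tensor, which can be extended and added; duality
then turns the corrected bracket into `Δ` (`LieTriple.exists_extends`).

All these formulas involve only `ι(U)`, its bracket and `A`. For equivalent pairs, `ι'⁻¹ ∘ ι` on `U`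
together with the identity on `A ⊕ T*M` therefore descends to an isomorphism `C → C'`
(`nonempty_maninIso`). The bijection on classes is then formal, as both equivalences are defined by
the same invariant. -/

noncomputable section

namespace DiracManin

set_option linter.unusedSectionVars false

/-! ### Linear topology of the fibres -/

section FibreInstances

variable {E : Type uE} [NormedAddCommGroup E] [NormedSpace ℝ E]
  {M : Type uM} [TopologicalSpace M] [ChartedSpace E M] (V : VBundle.{uE, uM, w} E M) (x : M)

/-- Local triviality identifies each fibre with the model, so its topology is the standard one of a
finite-dimensional space. Linear maps built fibre by fibre are then automatically continuous. -/
instance : T2Space (V.fib x) := FiberBundle.t2Space V.F V.fib x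

instance : FiniteDimensional ℝ (V.fib x) := VectorBundle.finiteDimensional ℝ V.F V.fib x

instance : IsTopologicalAddGroup (V.fib x) :=
  (VectorBundle.continuousLinearEquivAt ℝ V.F V.fib x).toContinuousAddEquiv.isTopologicalAddGroup

instance : ContinuousSMul ℝ (V.fib x) :=
  (VectorBundle.continuousLinearEquivAt ℝ V.F V.fib x).continuousSMul

end FibreInstances

/-! ### Smoothness of bundle maps tested on sections -/

section SectionSmooth

variable {E : Type uE} [NormedAddCommGroup E] [NormedSpace ℝ E] [FiniteDimensional ℝ E]
  {M : Type uM} [TopologicalSpace M] [ChartedSpace E M] [IsManifold 𝓘(ℝ, E) ∞ M] [T2Space M]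
  {V : VBundle.{uE, uM, w₁} E M} {W : VBundle.{uE, uM, w₂} E M}

/-- A fibrewise linear map is section-smooth if it maps smooth sections to smooth sections. -/
def SecSmooth (φ : ∀ x, V.fib x →L[ℝ] W.fib x) : Prop :=
  ∀ s : Sec V, ContMDiff 𝓘(ℝ, E) (𝓘(ℝ, E).prod 𝓘(ℝ, W.F)) ∞
    (fun x => TotalSpace.mk' W.F x (φ x (s x)))

/-- The coordinate expression of a section-smooth map near a point. -/
theorem SecSmooth.exists_coord {φ : ∀ x, V.fib x →L[ℝ] W.fib x} (hφ : SecSmooth φ) (x : M) :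
    ∃ (u : Set M) (L : M → V.F →L[ℝ] W.F), IsOpen u ∧ x ∈ u ∧
      u ⊆ (trivializationAt V.F V.fib x).baseSet ∧ u ⊆ (trivializationAt W.F W.fib x).baseSet ∧
      ContMDiffOn 𝓘(ℝ, E) 𝓘(ℝ, V.F →L[ℝ] W.F) ∞ L u ∧
      ∀ y ∈ u, ∀ v : V.fib y, (trivializationAt W.F W.fib x ⟨y, φ y v⟩).2
        = L y (trivializationAt V.F V.fib x ⟨y, v⟩).2 := by
  set e := trivializationAt V.F V.fib x
  set e' := trivializationAt W.F W.fib x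
  have hx : x ∈ e.baseSet := FiberBundle.mem_baseSet_trivializationAt' x
  have hx' : x ∈ e'.baseSet := FiberBundle.mem_baseSet_trivializationAt' x
  let b := Module.finBasis ℝ V.F
  choose s hs using fun i =>
    exists_sec_germ e.open_baseSet hx (e.contMDiffOn_localFrame_baseSet ∞ b i)
  obtain ⟨u₀, hu₀, ho, hxo⟩ := eventually_nhds_iff.1 (Filter.eventually_all.2 hs)
  -- The columns of `L` are the images of global sections that agree with the local frame near `x`,
  -- because section-smoothness speaks of global sections only.
  let L : M → V.F →L[ℝ] W.F := fun y => ∑ i,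
    (LinearMap.toContinuousLinearMap (b.coord i)).smulRight (e' ⟨y, φ y (s i y)⟩).2
  refine ⟨u₀ ∩ e.baseSet ∩ e'.baseSet, L, (ho.inter e.open_baseSet).inter e'.open_baseSet,
    ⟨⟨hxo, hx⟩, hx'⟩, fun y hy => hy.1.2, fun y hy => hy.2, ?_, ?_⟩
  · have h1 (i) : ContMDiffOn 𝓘(ℝ, E) 𝓘(ℝ, W.F) ∞ (fun y => (e' ⟨y, φ y (s i y)⟩).2) e'.baseSet :=
      (e'.contMDiffOn_section_baseSet_iff).1 (hφ (s i)).contMDiffOn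
    have h2 (i) : ContMDiffOn 𝓘(ℝ, E) 𝓘(ℝ, V.F →L[ℝ] W.F) ∞ (fun y =>
        (LinearMap.toContinuousLinearMap (b.coord i)).smulRight (e' ⟨y, φ y (s i y)⟩).2)
        e'.baseSet :=
      (ContinuousLinearMap.smulRightL ℝ V.F W.F
        (LinearMap.toContinuousLinearMap (b.coord i))).contMDiff.comp_contMDiffOn (h1 i)
    exact (contMDiffOn_finsetSum fun i _ => h2 i).mono fun y hy => hy.2
  · rintro y ⟨⟨hy, hye⟩, hye'⟩ v
    let T := e'.continuousLinearEquivAt ℝ y hye'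
    let S := e.continuousLinearEquivAt ℝ y hye
    have key : (T : W.fib y →L[ℝ] W.F) ∘L (φ y) ∘L (S.symm : V.F →L[ℝ] V.fib y) = L y := by
      apply ContinuousLinearMap.coe_injective
      refine b.ext fun j => ?_
      have h1 : L y (b j) = (e' ⟨y, φ y (s j y)⟩).2 := by
        simp only [L, sum_apply]
        rw [Finset.sum_eq_single j]
        · simp
        · intro i _ hij
          simp [hij.symm]
        · simp
      refine Eq.trans ?_ h1.symm
      have hj : s j y = e.symm y (b j) := by
        rw [hu₀ y hy j, e.localFrame_apply_of_mem_baseSet _ hye]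
        simp [Trivialization.basisAt]
      rw [hj]
      simp [T, S]
    have := congrArg (fun l => l (S v)) key
    simp only [ContinuousLinearMap.comp_apply, ContinuousLinearEquiv.coe_coe,
      ContinuousLinearEquiv.symm_apply_apply] at this
    exact this

/-- Invertible endomorphisms form an open set on which inversion is smooth. Shrinking to its
preimage also avoids the default value of `ContinuousLinearMap.inverse` at noninvertible maps. -/
theorem exists_local_inverse {F : Type w} [NormedAddCommGroup F] [NormedSpace ℝ F]
    [FiniteDimensional ℝ F] {u : Set M} (hu : IsOpen u) {x : M} (hx : x ∈ u) {G : M → F →L[ℝ] F}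
    (hG : ContMDiffOn 𝓘(ℝ, E) 𝓘(ℝ, F →L[ℝ] F) ∞ G u) (hGx : G x = ContinuousLinearMap.id ℝ F) :
    ∃ (u' : Set M) (H : M → F →L[ℝ] F), IsOpen u' ∧ x ∈ u' ∧ u' ⊆ u ∧
      ContMDiffOn 𝓘(ℝ, E) 𝓘(ℝ, F →L[ℝ] F) ∞ H u' ∧
      ∀ y ∈ u', (∀ v, H y (G y v) = v) ∧ ∀ v, G y (H y v) = v := by
  have : CompleteSpace F := FiniteDimensional.complete ℝ F
  have ho := ContinuousLinearEquiv.isOpen (𝕜 := ℝ) (E := F) (F := F)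
  refine ⟨u ∩ G ⁻¹' range ((↑) : (F ≃L[ℝ] F) → F →L[ℝ] F), fun y => (G y).inverse,
    hG.continuousOn.isOpen_inter_preimage hu ho, ⟨hx, ContinuousLinearEquiv.refl ℝ F, hGx.symm⟩,
    inter_subset_left, ?_, ?_⟩
  · rintro y ⟨hy, g, hg⟩
    have h := contDiffAt_map_inverse (𝕜 := ℝ) (n := ∞) g
    rw [hg] at h
    exact h.contMDiffAt.comp_contMDiffWithinAt y ((hG y hy).mono inter_subset_left)
  · rintro y ⟨hy, g, hg⟩
    simp [← hg]

/-- A section-smooth map is smooth on total spaces. -/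
def SecSmooth.toVBHom {φ : ∀ x, V.fib x →L[ℝ] W.fib x} (hφ : SecSmooth φ) : VBHom V W where
  app := φ
  smooth_app p := by
    obtain ⟨u, L, hu, hx, h1, h2, hL, h⟩ := hφ.exists_coord p.1
    have hp := contMDiffAt_totalSpace.1
      (contMDiffAt_id (I := 𝓘(ℝ, E).prod 𝓘(ℝ, V.F)) (n := ∞) (x := p))
    refine contMDiffAt_totalSpace.2 ⟨hp.1, ?_⟩
    have hL' := (hL.contMDiffAt (hu.mem_nhds hx)).comp p hp.1
    refine (hL'.clm_apply hp.2).congr_of_eventuallyEq ?_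
    filter_upwards [hp.1.continuousAt.preimage_mem_nhds (hu.mem_nhds hx)] with q hq
    exact h q.1 hq q.2

/-- An injective section-smooth map reflects smoothness of sections. -/
theorem SecSmooth.contMDiff_of_injective {φ : ∀ x, V.fib x →L[ℝ] W.fib x} (hφ : SecSmooth φ)
    (hinj : ∀ x, Function.Injective (φ x)) {s : ∀ x, V.fib x}
    (hs : ContMDiff 𝓘(ℝ, E) (𝓘(ℝ, E).prod 𝓘(ℝ, W.F)) ∞
      (fun x => TotalSpace.mk' W.F x (φ x (s x)))) :
    ContMDiff 𝓘(ℝ, E) (𝓘(ℝ, E).prod 𝓘(ℝ, V.F)) ∞ (fun x => TotalSpace.mk' V.F x (s x)) := by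
  intro x
  obtain ⟨u, L, hu, hx, h1, h2, hL, h⟩ := hφ.exists_coord x
  set e := trivializationAt V.F V.fib x
  set e' := trivializationAt W.F W.fib x
  have hLinj : LinearMap.ker (L x : V.F →ₗ[ℝ] W.F) = ⊥ := by
    refine LinearMap.ker_eq_bot.2 fun v v' hv => ?_
    let S := e.continuousLinearEquivAt ℝ x (h1 hx)
    let T := e'.continuousLinearEquivAt ℝ x (h2 hx)
    have key (v) : T (φ x (S.symm v)) = L x v :=
      (h x hx (S.symm v)).trans (congrArg (L x) (S.apply_symm_apply v))
    have hv' : L x v = L x v' := hv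
    rw [← key, ← key] at hv'
    exact S.symm.injective (hinj x (T.injective hv'))
  -- A left inverse of `L` at the single point `x` suffices: `K ∘ L y` is the identity at `x`, so it
  -- is invertible for `y` near `x`, and its inverse followed after `K` recovers the coordinates of
  -- `s`.
  obtain ⟨K, hK⟩ := LinearMap.exists_leftInverse_of_injective _ hLinj
  let K' := LinearMap.toContinuousLinearMap K
  have hG : ContMDiffOn 𝓘(ℝ, E) 𝓘(ℝ, V.F →L[ℝ] V.F) ∞ (fun y => K' ∘L L y) u :=
    contMDiffOn_const.clm_comp hL
  obtain ⟨u', H, hu', hx', hsub, hH, hHG⟩ := exists_local_inverse hu hx hG (by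
    ext v
    exact LinearMap.congr_fun hK v)
  rw [contMDiffAt_section]
  have h3 := (contMDiffAt_section x).1 (hs x)
  have h4 := (hH.contMDiffAt (hu'.mem_nhds hx')).clm_apply
    ((contMDiffAt_const (c := K')).clm_apply h3)
  refine h4.congr_of_eventuallyEq ?_
  filter_upwards [hu'.mem_nhds hx'] with y hy
  have h5 := h y (hsub hy) (s y)
  change (e ⟨y, s y⟩).2 = H y (K' (e' ⟨y, φ y (s y)⟩).2)
  rw [h5]
  exact ((hHG y hy).1 _).symm

/-- Sections lift locally along surjective section-smooth maps. -/
theorem SecSmooth.exists_local_lift {φ : ∀ x, V.fib x →L[ℝ] W.fib x} (hφ : SecSmooth φ)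
    (x : M) (hsurj : Function.Surjective (φ x)) (s : Sec W) :
    ∃ (u : Set M) (t : ∀ x, V.fib x), IsOpen u ∧ x ∈ u ∧
      ContMDiffOn 𝓘(ℝ, E) (𝓘(ℝ, E).prod 𝓘(ℝ, V.F)) ∞ (fun x => TotalSpace.mk' V.F x (t x)) u ∧
      ∀ y ∈ u, φ y (t y) = s y := by
  obtain ⟨u, L, hu, hx, h1, h2, hL, h⟩ := hφ.exists_coord x
  set e := trivializationAt V.F V.fib x
  set e' := trivializationAt W.F W.fib x
  have hLsurj : LinearMap.range (L x : V.F →ₗ[ℝ] W.F) = ⊤ := by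
    refine LinearMap.range_eq_top.2 fun v => ?_
    let T := e'.continuousLinearEquivAt ℝ x (h2 hx)
    obtain ⟨a, ha⟩ := hsurj (T.symm v)
    refine ⟨(e ⟨x, a⟩).2, (h x hx a).symm.trans ?_⟩
    rw [ha]
    exact T.apply_symm_apply v
  -- Dually, a constant right inverse at `x` is corrected by the inverse `H y` of `L y ∘ R`, and `R
  -- (H y ·)` solves the equation near `x`.
  obtain ⟨R, hR⟩ := LinearMap.exists_rightInverse_of_surjective _ hLsurj
  let R' := LinearMap.toContinuousLinearMap R
  have hG : ContMDiffOn 𝓘(ℝ, E) 𝓘(ℝ, W.F →L[ℝ] W.F) ∞ (fun y => L y ∘L R') u :=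
    hL.clm_comp contMDiffOn_const
  obtain ⟨u', H, hu', hx', hsub, hH, hHG⟩ := exists_local_inverse hu hx hG (by
    ext v
    exact LinearMap.congr_fun hR v)
  refine ⟨u', fun y => e.symm y (R' (H y (e' ⟨y, s y⟩).2)), hu', hx', ?_, ?_⟩
  · refine (e.contMDiffOn_section_iff hu' (fun y hy => h1 (hsub hy))).2 ?_
    have h3 : ContMDiffOn 𝓘(ℝ, E) 𝓘(ℝ, W.F) ∞ (fun y => (e' ⟨y, s y⟩).2) u' :=
      (e'.contMDiffOn_section_iff hu' (fun y hy => h2 (hsub hy))).1 s.contMDiff.contMDiffOn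
    refine ((contMDiffOn_const (c := R')).clm_apply (hH.clm_apply h3)).congr fun y hy => ?_
    rw [e.apply_mk_symm (h1 (hsub hy))]
  · intro y hy
    let T := e'.continuousLinearEquivAt ℝ y (h2 (hsub hy))
    refine T.injective ((h y (hsub hy) _).trans ?_)
    rw [e.apply_mk_symm (h1 (hsub hy))]
    exact (hHG y hy).2 _

/-- Sections lift along surjective section-smooth maps. -/
theorem SecSmooth.exists_lift [SigmaCompactSpace M] {φ : ∀ x, V.fib x →L[ℝ] W.fib x}
    (hφ : SecSmooth φ) (hsurj : ∀ x, Function.Surjective (φ x)) (s : Sec W) :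
    ∃ t : Sec V, ∀ x, φ x (t x) = s x := by
  -- The solutions in each fibre form an affine, hence convex, set, so a partition of unity glues
  -- local lifts.
  refine exists_contMDiffSection_forall_mem_convex_of_local (n := ⊤) (F_fiber := V.F) 𝓘(ℝ, E) V.fib
    (fun x => {v | φ x v = s x}) (fun x => ?_) fun x => ?_
  · exact (convex_singleton (s x)).is_linear_preimage (φ x).toLinearMap.isLinear
  · obtain ⟨u, t, hu, hx, ht, h⟩ := hφ.exists_local_lift x (hsurj x) s
    exact ⟨u, hu.mem_nhds hx, t, ht, h⟩

theorem VBHom.secSmooth (φ : VBHom V W) : SecSmooth φ.app := fun s => (φ.map s).contMDiff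

/-- The lift of a section along an injective bundle morphism. -/
def VBHom.lift (φ : VBHom V W) (hφ : ∀ x, Function.Injective (φ.app x)) (s : Sec W)
    (h : ∀ x, ∃ v, φ.app x v = s x) : Sec V :=
  ⟨fun x => (h x).choose, φ.secSmooth.contMDiff_of_injective hφ
    (s.contMDiff.congr fun x => by rw [(h x).choose_spec])⟩

theorem VBHom.map_lift (φ : VBHom V W) (hφ : ∀ x, Function.Injective (φ.app x)) (s : Sec W)
    (h : ∀ x, ∃ v, φ.app x v = s x) : φ.map (φ.lift hφ s h) = s := by
  ext x
  exact (h x).choose_spec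

end SectionSmooth

/-! ### Algebraic rules for sections, brackets and function multiples -/

section Algebra

variable {E : Type uE} [NormedAddCommGroup E] [NormedSpace ℝ E] [FiniteDimensional ℝ E]
  {M : Type uM} [TopologicalSpace M] [ChartedSpace E M] [IsManifold 𝓘(ℝ, E) ∞ M]
  {V : VBundle.{uE, uM, w₁} E M} {W : VBundle.{uE, uM, w₂} E M}

theorem VBHom.map_add (φ : VBHom V W) (s t : Sec V) : φ.map (s + t) = φ.map s + φ.map t := by
  ext x
  exact _root_.map_add (φ.app x) _ _

theorem VBHom.map_sub (φ : VBHom V W) (s t : Sec V) : φ.map (s - t) = φ.map s - φ.map t := by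
  ext x
  exact _root_.map_sub (φ.app x) _ _

theorem VBHom.map_fmul (φ : VBHom V W) (f : Fn E M) (s : Sec V) :
    φ.map (fmul f s) = fmul f (φ.map s) := by
  ext x
  exact map_smul (φ.app x) _ _

theorem fmul_sub (f : Fn E M) (s t : Sec V) : fmul f (s - t) = fmul f s - fmul f t := by
  ext x
  exact smul_sub (f x) (s x) (t x)

theorem fmul_neg (f : Fn E M) (s : Sec V) : fmul f (-s) = -fmul f s := by
  ext x
  exact smul_neg (f x) (s x)

/-- Treating real scalars as constant functions reduces real homogeneity to the Leibniz rules. -/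
theorem smul_eq_fmul (r : ℝ) (s : Sec V) :
    r • s = fmul (ContMDiffMap.const r : Fn E M) s := rfl

theorem lieFn_const (X : Sec (tangent E M)) (r : ℝ) :
    lieFn X (ContMDiffMap.const r : Fn E M) = 0 := by
  ext x
  change mvfderiv 𝓘(ℝ, E) (fun _ : M => r) x (X x) = 0
  rw [mvfderiv_const]
  rfl

theorem vbr_fmul_left (f : Fn E M) (X Y : Sec (tangent E M)) :
    vbr (fmul f X) Y = fmul f (vbr X Y) - fmul (lieFn Y f) X := by
  rw [vbr_skew, vbr_fmul, vbr_skew Y X, fmul_neg]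
  abel

theorem vbr_add_left (X Y Z : Sec (tangent E M)) : vbr (X + Y) Z = vbr X Z + vbr Y Z := by
  rw [vbr_skew, vbr_add, vbr_skew Z X, vbr_skew Z Y]
  abel

theorem LieAlgebroid.bracket_fmul_left (LA : LieAlgebroid V) (f : Fn E M) (a b : Sec V) :
    LA.bracket (fmul f a) b = fmul f (LA.bracket a b) - fmul (lieFn (LA.anchor.map b) f) a := by
  rw [LA.skew, LA.leibniz, LA.skew b a, fmul_neg]
  abel

theorem sec_sum_apply {ι : Type*} (I : Finset ι) (s : ι → Sec V) (x : M) :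
    (∑ i ∈ I, s i) x = ∑ i ∈ I, s i x := by
  have := congrFun (map_sum (ContMDiffSection.coeAddHom 𝓘(ℝ, E) V.F ∞ V.fib) s I) x
  rw [Finset.sum_apply] at this
  exact this

theorem fmul_sum {ι : Type*} (I : Finset ι) (f : Fn E M) (s : ι → Sec V) :
    fmul f (∑ i ∈ I, s i) = ∑ i ∈ I, fmul f (s i) :=
  map_sum (AddMonoidHom.mk' (fmul f) (fmul_add f)) s I

theorem fmul_fmul (f g : Fn E M) (s : Sec V) : fmul f (fmul g s) = fmul (f * g) s := by
  ext x
  exact smul_smul (f x) (g x) (s x)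

theorem pairSec_add_zero (s t : Sec V) :
    (pairSec (s + t) 0 : Sec (V.prod W)) = pairSec s 0 + pairSec t 0 := by
  ext1 x
  exact Prod.ext rfl (add_zero (0 : W.fib x)).symm

theorem pairSec_zero_add (s t : Sec W) :
    (pairSec 0 (s + t) : Sec (V.prod W)) = pairSec 0 s + pairSec 0 t := by
  ext1 x
  exact Prod.ext (add_zero (0 : V.fib x)).symm rfl

theorem pairSec_fmul_zero (f : Fn E M) (s : Sec V) :
    (pairSec (fmul f s) 0 : Sec (V.prod W)) = fmul f (pairSec s 0) := by
  ext1 x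
  exact Prod.ext rfl (smul_zero (f x) : f x • (0 : W.fib x) = 0).symm

theorem pairSec_zero_fmul (f : Fn E M) (s : Sec W) :
    (pairSec 0 (fmul f s) : Sec (V.prod W)) = fmul f (pairSec 0 s) := by
  ext1 x
  exact Prod.ext (smul_zero (f x) : f x • (0 : V.fib x) = 0).symm rfl

theorem pairSec_fst_add_snd (s : Sec (V.prod W)) : pairSec s.fst 0 + pairSec 0 s.snd = s := by
  ext1 x
  exact Prod.ext (add_zero (s.fst x)) (zero_add (s.snd x))

end Algebra

/-! ### Partitions of unity: frames, connections and retractions -/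

section Gluing

variable {E : Type uE} [NormedAddCommGroup E] [NormedSpace ℝ E] [FiniteDimensional ℝ E]
  {M : Type uM} [TopologicalSpace M] [ChartedSpace E M] [IsManifold 𝓘(ℝ, E) ∞ M] [T2Space M]
  {V : VBundle.{uE, uM, w₁} E M} {W : VBundle.{uE, uM, w₂} E M}

/-- The section `∑ fⱼ sⱼ` for a partition of unity `f`. -/
def glue (f : SmoothPartitionOfUnity M 𝓘(ℝ, E) M univ) (s : M → Sec V) : Sec V :=
  ⟨fun x => ∑ᶠ j, f j x • s j x,
    ContMDiff.finsum_section_of_locallyFinite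
      (f.locallyFinite.subset fun _ _ hx => left_ne_zero_of_smul hx)
      fun j => (f j).contMDiff.smul_section (s j).contMDiff⟩

theorem glue_apply (f : SmoothPartitionOfUnity M 𝓘(ℝ, E) M univ) (s : M → Sec V) (x : M) :
    glue f s x = ∑ j ∈ f.finsupport x, f j x • s j x := by
  refine finsum_eq_sum_of_support_subset _ fun j hj => ?_
  exact (f.mem_finsupport x).2 (left_ne_zero_of_smul hj)

theorem glue_add (f : SmoothPartitionOfUnity M 𝓘(ℝ, E) M univ) (s t : M → Sec V) :
    glue f (fun j => s j + t j) = glue f s + glue f t := by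
  ext x
  change _ = glue f s x + glue f t x
  simp only [glue_apply, ← Finset.sum_add_distrib, ← smul_add]
  rfl

theorem glue_fmul (f : SmoothPartitionOfUnity M 𝓘(ℝ, E) M univ) (g : Fn E M) (s : M → Sec V) :
    glue f (fun j => fmul g (s j)) = fmul g (glue f s) := by
  ext x
  change _ = g x • glue f s x
  simp only [glue_apply, Finset.smul_sum]
  exact Finset.sum_congr rfl fun j _ => smul_comm _ _ _

/-- At a given point only indices whose set contains the point carry a nonzero weight, and the
weights sum to one. -/
theorem glue_eq (f : SmoothPartitionOfUnity M 𝓘(ℝ, E) M univ) {u : M → Set M}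
    (hf : f.IsSubordinate u) {s : M → Sec V} {t : Sec V} (h : ∀ j, ∀ x ∈ u j, s j x = t x) :
    glue f s = t := by
  ext x
  rw [glue_apply]
  have h1 : ∀ j ∈ f.finsupport x, f j x • s j x = f j x • t x := fun j hj => by
    rw [h j x (hf j (subset_closure ((f.mem_finsupport x).1 hj)))]
  rw [Finset.sum_congr rfl h1, ← Finset.sum_smul, f.sum_finsupport x (mem_univ x), one_smul]

/-- Local frames and coframes consisting of global sections. -/
theorem exists_frame (V : VBundle.{uE, uM, w₁} E M) (x : M) :
    ∃ (u : Set M) (n : ℕ) (c : Fin n → Sec V.dual) (t : Fin n → Sec V), IsOpen u ∧ x ∈ u ∧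
      ∀ s : Sec V, ∀ y ∈ u, (∑ i, fmul (evalSec (c i) s) (t i)) y = s y := by
  let e := trivializationAt V.F V.fib x
  have hx : x ∈ e.baseSet := FiberBundle.mem_baseSet_trivializationAt' x
  let b := Module.finBasis ℝ V.F
  obtain ⟨ψ, h1, h2⟩ := exists_bump (E := E) (e.open_baseSet.mem_nhds hx)
  choose t ht using fun i =>
    exists_sec_germ e.open_baseSet hx (e.contMDiffOn_localFrame_baseSet ∞ b i)
  -- The cutoff `ψ` turns the coefficient functionals into global dual sections; on the final
  -- neighbourhood `ψ = 1`, so they are the true coefficients there.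
  let c (i) (y : M) : V.dual.fib y :=
    LinearMap.toContinuousLinearMap (ψ y • e.localFrameCoeff 𝓘(ℝ, E) b i y)
  have hc (i) : ContMDiff 𝓘(ℝ, E) (𝓘(ℝ, E).prod 𝓘(ℝ, V.dual.F)) ∞
      (fun y => TotalSpace.mk' V.dual.F y (c i y)) := by
    refine contMDiff_dual _ fun s => contMDiff_of_tsupport fun y hy => ?_
    have hy' : y ∈ e.baseSet := h1 (closure_mono (Function.support_mul_subset_left ψ _) hy)
    exact (ψ.contMDiff y).mul ((contMDiffOn_baseSet_localFrameCoeff (b := b)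
      s.contMDiff.contMDiffOn i).contMDiffAt (e.open_baseSet.mem_nhds hy'))
  obtain ⟨u, hu, ho, hxu⟩ := eventually_nhds_iff.1
    ((Filter.eventually_all.2 ht).and (h2.and (e.open_baseSet.mem_nhds hx)))
  refine ⟨u, _, fun i => ⟨c i, hc i⟩, t, ho, hxu, fun s y hy => ?_⟩
  obtain ⟨h3, h4, h5⟩ := hu y hy
  rw [sec_sum_apply]
  refine Eq.trans ?_ (e.eq_sum_localFrameCoeff_smul (I := 𝓘(ℝ, E)) (b := b) (s := s) h5).symm
  refine Finset.sum_congr rfl fun i _ => ?_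
  change (ψ y * e.localFrameCoeff 𝓘(ℝ, E) b i y (s y)) • t i y = _
  rw [h4, h3 i, one_mul]

variable [SigmaCompactSpace M]

/-- Linear connections on a vector bundle. -/
structure LinConnection (V : VBundle.{uE, uM, w₁} E M) where
  D : Sec (tangent E M) → Sec V → Sec V
  add_left : ∀ X Y s, D (X + Y) s = D X s + D Y s
  add_right : ∀ X s t, D X (s + t) = D X s + D X t
  fmul_left : ∀ (f : Fn E M) X s, D (fmul f X) s = fmul f (D X s)
  leibniz : ∀ X (f : Fn E M) s, D X (fmul f s) = fmul f (D X s) + fmul (lieFn X f) s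

/-- Differentiate the coefficients in each local frame and glue. The frame expansion enters only in
the Leibniz rule, where the terms `(X g) ∑ cᵢ(s) tᵢ` must glue to `(X g) s`. -/
theorem exists_linConnection (V : VBundle.{uE, uM, w₁} E M) : Nonempty (LinConnection V) := by
  choose u n c t hu hx h using exists_frame V
  obtain ⟨f, hf⟩ := SmoothPartitionOfUnity.exists_isSubordinate 𝓘(ℝ, E) isClosed_univ u hu
    (fun x _ => mem_iUnion.2 ⟨x, hx x⟩)
  exact ⟨{
    D X s := glue f fun j => ∑ i, fmul (lieFn X (evalSec (c j i) s)) (t j i)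
    add_left X Y s := by
      rw [← glue_add]
      simp only [lieFn_add_left, add_fmul, Finset.sum_add_distrib]
    add_right X s s' := by
      rw [← glue_add]
      simp only [evalSec_add, lieFn_add, add_fmul, Finset.sum_add_distrib]
    fmul_left g X s := by
      rw [← glue_fmul]
      refine congrArg (glue f) (funext fun j => ?_)
      simp only [fmul_sum, fmul_fmul, lieFn_fmul]
    leibniz X g s := by
      have h1 : glue f (fun j => fmul (lieFn X g) (∑ i, fmul (evalSec (c j i) s) (t j i)))
          = fmul (lieFn X g) s := by
        rw [glue_fmul, glue_eq f hf fun j x hx => h j s x hx]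
      rw [← h1, ← glue_fmul, ← glue_add]
      refine congrArg (glue f) (funext fun j => ?_)
      simp only [fmul_sum, fmul_fmul, evalSec_fmul, lieFn_mul, add_fmul, Finset.sum_add_distrib] }⟩

/-- An injective bundle morphism has a `C^∞(M)`-linear retraction on sections. -/
theorem VBHom.exists_retraction (φ : VBHom V W) (hφ : ∀ x, Function.Injective (φ.app x)) :
    ∃ p : Sec W → Sec V, (∀ s t, p (s + t) = p s + p t) ∧
      (∀ (f : Fn E M) s, p (fmul f s) = fmul f (p s)) ∧ ∀ s, p (φ.map s) = s := by
  -- The transpose of an injective map is surjective, so a coframe of `V` lifts to sections of the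
  -- dual of `W`. Lifted coframe and frame together give a local retraction, and function-linearity
  -- survives gluing.
  let φt (x : M) : W.dual.fib x →L[ℝ] V.dual.fib x := LinearMap.toContinuousLinearMap
    { toFun := fun σ => σ.comp (φ.app x)
      map_add' := fun _ _ => ContinuousLinearMap.add_comp _ _ _
      map_smul' := fun _ _ => ContinuousLinearMap.smul_comp _ _ _ }
  have hsm : SecSmooth φt := fun σ => contMDiff_dual _ fun s => (evalSec σ (φ.map s)).contMDiff
  have hsurj (x) : Function.Surjective (φt x) := fun σ => by
    obtain ⟨K, hK⟩ := LinearMap.exists_leftInverse_of_injective (φ.app x).toLinearMap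
      (LinearMap.ker_eq_bot.2 (hφ x))
    let K' : W.fib x →L[ℝ] V.fib x := LinearMap.toContinuousLinearMap K
    refine ⟨σ.comp K', ?_⟩
    ext v
    exact congrArg σ (LinearMap.congr_fun hK v)
  choose u n c t hu hx h using exists_frame V
  obtain ⟨f, hf⟩ := SmoothPartitionOfUnity.exists_isSubordinate 𝓘(ℝ, E) isClosed_univ u hu
    (fun x _ => mem_iUnion.2 ⟨x, hx x⟩)
  choose c' hc' using fun j i => hsm.exists_lift hsurj (c j i)
  refine ⟨fun s => glue f fun j => ∑ i, fmul (evalSec (c' j i) s) (t j i), ?_, ?_, ?_⟩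
  · intro s s'
    rw [← glue_add]
    simp only [evalSec_add, add_fmul, Finset.sum_add_distrib]
  · intro g s
    rw [← glue_fmul]
    refine congrArg (glue f) (funext fun j => ?_)
    simp only [fmul_sum, fmul_fmul, evalSec_fmul]
  · intro s
    refine glue_eq f hf fun j x hx => ?_
    have h2 (i) : evalSec (c' j i) (φ.map s) = evalSec (c j i) s := by
      ext y
      exact congrArg (fun l : V.dual.fib y => l (s y)) (hc' j i y)
    simp only [h2]
    exact h j s x hx

end Gluing

/-! ### Biduality and the pairing of `TM ⊕ A*` with `A ⊕ T*M` -/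

section Duality

variable {E : Type uE} [NormedAddCommGroup E] [NormedSpace ℝ E] [FiniteDimensional ℝ E]
  {M : Type uM} [TopologicalSpace M] [ChartedSpace E M] [IsManifold 𝓘(ℝ, E) ∞ M] [T2Space M]
  {V : VBundle.{uE, uM, w₁} E M} {A : VBundle.{uE, uM, w} E M}

theorem eq_zero_of_dual {x : M} {v : V.fib x} (h : ∀ σ : V.dual.fib x, (σ v : ℝ) = 0) : v = 0 :=
  (Module.forall_dual_apply_eq_zero_iff ℝ v).1 fun l => h (LinearMap.toContinuousLinearMap l)

theorem exists_eval_eq {x : M} (Λ : V.dual.fib x →ₗ[ℝ] ℝ) :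
    ∃ v : V.fib x, ∀ σ : V.dual.fib x, Λ σ = σ v := by
  let T : (V.fib x →ₗ[ℝ] ℝ) ≃ₗ[ℝ] V.dual.fib x := LinearMap.toContinuousLinearMap
  obtain ⟨v, hv⟩ := (Module.evalEquiv ℝ (V.fib x)).surjective (Λ.comp T.toLinearMap)
  refine ⟨v, fun σ => ?_⟩
  have := LinearMap.congr_fun hv (T.symm σ)
  rw [LinearMap.comp_apply, LinearEquiv.coe_coe, T.apply_symm_apply] at this
  exact this.symm

/-- Every `C^∞(M)`-linear functional on sections of the dual is evaluation on a section. -/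
theorem exists_sec_of_dual (φ : Sec V.dual → Fn E M) (hadd : ∀ s t, φ (s + t) = φ s + φ t)
    (hmul : ∀ (f : Fn E M) s, φ (fmul f s) = f * φ s) :
    ∃ s : Sec V, ∀ σ, evalSec σ s = φ σ := by
  -- The functional is a smooth section of the double dual. Finite-dimensional reflexivity gives its
  -- preimage pointwise, and injectivity of `ev` makes that preimage smooth.
  let ev (x : M) : V.fib x →L[ℝ] V.dual.dual.fib x := LinearMap.toContinuousLinearMap
    { toFun := fun v =>
        (LinearMap.toContinuousLinearMap
          { toFun := fun σ : V.dual.fib x => (σ v : ℝ)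
            map_add' := fun _ _ => rfl
            map_smul' := fun _ _ => rfl } : V.dual.fib x →L[ℝ] ℝ)
      map_add' := fun v v' => by
        ext σ
        exact map_add σ v v'
      map_smul' := fun r v => by
        ext σ
        exact map_smul σ r v }
  have hev : SecSmooth ev := fun s => contMDiff_dual _ fun σ => (evalSec σ s).contMDiff
  have hinj (x) : Function.Injective (ev x) := (injective_iff_map_eq_zero (ev x)).2
    fun v hv => eq_zero_of_dual fun σ => congrArg (fun l : V.dual.dual.fib x => l σ) hv
  let Λ := ofTensorial φ hadd hmul
  have hsurj (x) : ∃ v, ev x v = Λ x := by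
    obtain ⟨v, hv⟩ := exists_eval_eq (Λ x : V.dual.fib x →ₗ[ℝ] ℝ)
    refine ⟨v, ?_⟩
    ext σ
    exact (hv σ).symm
  refine ⟨hev.toVBHom.lift hinj Λ hsurj, fun σ => ?_⟩
  rw [← evalSec_ofTensorial φ hadd hmul σ]
  ext x
  have := congrArg (fun s : Sec V.dual.dual => s x (σ x)) (hev.toVBHom.map_lift hinj Λ hsurj)
  exact this

theorem dualPair_eq_zero_left {x : M} {ν : A.Q.fib x} (h : ∀ τ, dualPair x ν τ = 0) : ν = 0 := by
  refine Prod.ext (eq_zero_of_dual (V := tangent E M) fun θ => ?_)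
    (ContinuousLinearMap.ext fun a => ?_)
  · have h1 : (ν.2 0 : ℝ) + θ ν.1 = 0 := h (0, θ)
    rwa [map_zero, show (0 : Trivial M ℝ x) = (0 : ℝ) from rfl, zero_add] at h1
  · exact (add_zero (ν.2 a : ℝ)).symm.trans (h (a, 0))

theorem dualPair_eq_zero_right {x : M} {τ : A.B.fib x} (h : ∀ ν, dualPair x ν τ = 0) : τ = 0 := by
  refine Prod.ext (eq_zero_of_dual fun α => ?_) (ContinuousLinearMap.ext fun X => ?_)
  · have h1 : (α τ.1 : ℝ) + τ.2 0 = 0 := h (0, α)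
    rwa [map_zero, show (0 : Trivial M ℝ x) = (0 : ℝ) from rfl, add_zero] at h1
  · exact (zero_add (τ.2 X : ℝ)).symm.trans (h (X, 0))

theorem dualPair_sub_left {x : M} (ν ν' : A.Q.fib x) (τ : A.B.fib x) :
    dualPair x (ν - ν') τ = dualPair x ν τ - dualPair x ν' τ := by
  change (ν.2 τ.1 - ν'.2 τ.1 : ℝ) + (τ.2 (ν.1 - ν'.1) : ℝ) = (ν.2 τ.1 + τ.2 ν.1 : ℝ)
    - (ν'.2 τ.1 + τ.2 ν'.1 : ℝ)
  rw [map_sub]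
  exact add_sub_add_comm _ _ _ _ |>.symm

theorem dualPair_sub_right {x : M} (ν : A.Q.fib x) (τ τ' : A.B.fib x) :
    dualPair x ν (τ - τ') = dualPair x ν τ - dualPair x ν τ' := by
  change (ν.2 (τ.1 - τ'.1) : ℝ) + (τ.2 ν.1 - τ'.2 ν.1 : ℝ) = (ν.2 τ.1 + τ.2 ν.1 : ℝ)
    - (ν.2 τ'.1 + τ'.2 ν.1 : ℝ)
  rw [map_sub]
  exact add_sub_add_comm _ _ _ _ |>.symm

theorem dualPair_ext_left {x : M} {ν ν' : A.Q.fib x}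
    (h : ∀ τ, dualPair x ν τ = dualPair x ν' τ) : ν = ν' :=
  sub_eq_zero.1 (dualPair_eq_zero_left fun τ => by rw [dualPair_sub_left, h, sub_self])

theorem dualPairFn_ext_right {τ τ' : Sec A.B} (h : ∀ ν, dualPairFn ν τ = dualPairFn ν τ') :
    τ = τ' := by
  ext1 x
  refine sub_eq_zero.1 (dualPair_eq_zero_right fun ν => ?_)
  obtain ⟨ν, rfl⟩ := exists_sec_apply (E := E) ν
  rw [dualPair_sub_right]
  exact sub_eq_zero.2 (congrArg (fun f : Fn E M => f x) (h ν))

theorem dualPairFn_ext_left {ν ν' : Sec A.Q} (h : ∀ τ, dualPairFn ν τ = dualPairFn ν' τ) :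
    ν = ν' := by
  ext1 x
  refine dualPair_ext_left fun τ => ?_
  obtain ⟨τ, rfl⟩ := exists_sec_apply (E := E) τ
  exact congrArg (fun f : Fn E M => f x) (h τ)

theorem evalSec_add_left (σ σ' : Sec V.dual) (s : Sec V) :
    evalSec (σ + σ') s = evalSec σ s + evalSec σ' s := rfl

theorem evalSec_sub_left (σ σ' : Sec V.dual) (s : Sec V) :
    evalSec (σ - σ') s = evalSec σ s - evalSec σ' s := rfl

theorem evalSec_fmul_left (f : Fn E M) (σ : Sec V.dual) (s : Sec V) :
    evalSec (fmul f σ) s = f * evalSec σ s := rfl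

theorem evalSec_zero (σ : Sec V.dual) : evalSec σ 0 = 0 := by
  ext x
  exact map_zero (σ x)

theorem dualPairFn_add_left (ν ν' : Sec A.Q) (τ : Sec A.B) :
    dualPairFn (ν + ν') τ = dualPairFn ν τ + dualPairFn ν' τ := by
  change evalSec (ν.snd + ν'.snd) τ.fst + evalSec τ.snd (ν.fst + ν'.fst) = _
  rw [evalSec_add_left, evalSec_add]
  exact add_add_add_comm _ _ _ _

theorem dualPairFn_add_right (ν : Sec A.Q) (τ τ' : Sec A.B) :
    dualPairFn ν (τ + τ') = dualPairFn ν τ + dualPairFn ν τ' := by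
  change evalSec ν.snd (τ.fst + τ'.fst) + evalSec (τ.snd + τ'.snd) ν.fst = _
  rw [evalSec_add_left, evalSec_add]
  exact add_add_add_comm _ _ _ _

theorem dualPairFn_sub_left (ν ν' : Sec A.Q) (τ : Sec A.B) :
    dualPairFn (ν - ν') τ = dualPairFn ν τ - dualPairFn ν' τ := by
  ext x
  exact dualPair_sub_left _ _ _

theorem dualPairFn_fmul_left (f : Fn E M) (ν : Sec A.Q) (τ : Sec A.B) :
    dualPairFn (fmul f ν) τ = f * dualPairFn ν τ := by
  change evalSec (fmul f ν.snd) τ.fst + evalSec τ.snd (fmul f ν.fst) = _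
  rw [evalSec_fmul_left, evalSec_fmul]
  exact (mul_add _ _ _).symm

theorem dualPairFn_fmul_right (f : Fn E M) (ν : Sec A.Q) (τ : Sec A.B) :
    dualPairFn ν (fmul f τ) = f * dualPairFn ν τ := by
  change evalSec ν.snd (fmul f τ.fst) + evalSec (fmul f τ.snd) ν.fst = _
  rw [evalSec_fmul_left, evalSec_fmul]
  exact (mul_add _ _ _).symm

theorem dualPairFn_pairSec_zero (ν : Sec A.Q) (θ : Sec (tangent E M).dual) :
    dualPairFn ν (pairSec 0 θ) = evalSec θ ν.fst := by
  change evalSec ν.snd 0 + evalSec θ ν.fst = _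
  rw [evalSec_zero, zero_add]

theorem dualPairFn_dFn (ν : Sec A.Q) (f : Fn E M) :
    dualPairFn ν (pairSec 0 (dFn f)) = lieFn ν.fst f :=
  dualPairFn_pairSec_zero _ _

/-- `A ⊕ T*M` is the dual of `TM ⊕ A*`. -/
theorem exists_dualPairFn_eq (φ : Sec A.Q → Fn E M) (hadd : ∀ s t, φ (s + t) = φ s + φ t)
    (hmul : ∀ (f : Fn E M) s, φ (fmul f s) = f * φ s) :
    ∃ τ : Sec A.B, ∀ ν, dualPairFn ν τ = φ ν := by
  obtain ⟨a, ha⟩ := exists_sec_of_dual (V := A) (fun β => φ (pairSec 0 β))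
    (fun s t => by rw [pairSec_zero_add, hadd]) fun f s => by rw [pairSec_zero_fmul, hmul]
  let θ := ofTensorial (V := tangent E M) (fun X => φ (pairSec X 0))
    (fun s t => by rw [pairSec_add_zero, hadd]) fun f s => by rw [pairSec_fmul_zero, hmul]
  refine ⟨pairSec a θ, fun ν => ?_⟩
  change evalSec ν.snd a + evalSec θ ν.fst = _
  rw [ha, evalSec_ofTensorial, ← hadd, add_comm, pairSec_fst_add_snd]

end Duality

/-! ### Dull brackets and Dorfman connections extending `L^U` -/

section Dull

variable {E : Type uE} [NormedAddCommGroup E] [NormedSpace ℝ E] [FiniteDimensional ℝ E]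
  {M : Type uM} [TopologicalSpace M] [ChartedSpace E M] [IsManifold 𝓘(ℝ, E) ∞ M] [T2Space M]
  {A : VBundle.{uE, uM, w} E M}

/-- Dull brackets on `TM ⊕ A*`, anchored by the projection to `TM`. -/
structure DullBracket (A : VBundle.{uE, uM, w} E M) where
  br : Sec A.Q → Sec A.Q → Sec A.Q
  add_left : ∀ ν ν' μ, br (ν + ν') μ = br ν μ + br ν' μ
  add_right : ∀ ν μ μ', br ν (μ + μ') = br ν μ + br ν μ'
  fmul_left : ∀ (f : Fn E M) ν μ, br (fmul f ν) μ = fmul f (br ν μ) - fmul (lieFn μ.fst f) ν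
  fmul_right : ∀ ν (f : Fn E M) μ, br ν (fmul f μ) = fmul f (br ν μ) + fmul (lieFn ν.fst f) μ
  anchor : ∀ ν μ, (br ν μ).fst = vbr ν.fst μ.fst

/-- The Dorfman connection dual to a dull bracket. -/
theorem DullBracket.exists_dorfman (b : DullBracket A) : ∃ Δ : DorfmanConnection A,
    ∀ ν μ τ, dualPairFn μ (Δ.D ν τ) = lieFn ν.fst (dualPairFn μ τ) - dualPairFn (b.br ν μ) τ := by
  -- The prescribed value is function-linear in `μ`, since the derivative terms from the two Leibniz
  -- rules cancel; duality then represents it by a section of `A ⊕ T*M`.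
  choose D hD using fun ν τ => exists_dualPairFn_eq (A := A)
    (fun μ => lieFn ν.fst (dualPairFn μ τ) - dualPairFn (b.br ν μ) τ)
    (fun μ μ' => by
      rw [b.add_right, dualPairFn_add_left, dualPairFn_add_left, lieFn_add]
      ring)
    (fun f μ => by
      rw [b.fmul_right, dualPairFn_add_left, dualPairFn_fmul_left, dualPairFn_fmul_left,
        dualPairFn_fmul_left, lieFn_mul]
      ring)
  have add_left (ν ν' τ) : D (ν + ν') τ = D ν τ + D ν' τ := dualPairFn_ext_right fun μ => by
    rw [dualPairFn_add_right, hD, hD, hD, b.add_left, dualPairFn_add_left,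
      show (ν + ν').fst = ν.fst + ν'.fst from rfl, lieFn_add_left]
    ring
  have add_right (ν τ τ') : D ν (τ + τ') = D ν τ + D ν τ' := dualPairFn_ext_right fun μ => by
    rw [dualPairFn_add_right, hD, hD, hD, dualPairFn_add_right, dualPairFn_add_right, lieFn_add]
    ring
  have derivation (ν) (f : Fn E M) (τ) :
      D ν (fmul f τ) = fmul f (D ν τ) + fmul (lieFn ν.fst f) τ := dualPairFn_ext_right fun μ => by
    rw [dualPairFn_add_right, dualPairFn_fmul_right, dualPairFn_fmul_right, hD, hD,
      dualPairFn_fmul_right, dualPairFn_fmul_right, lieFn_mul]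
    ring
  have fmul_left (f : Fn E M) (ν τ) :
      D (fmul f ν) τ = fmul f (D ν τ) + fmul (dualPairFn ν τ) (pairSec 0 (dFn f)) :=
    dualPairFn_ext_right fun μ => by
      rw [dualPairFn_add_right, dualPairFn_fmul_right, dualPairFn_fmul_right, hD, hD,
        dualPairFn_dFn, b.fmul_left, dualPairFn_sub_left, dualPairFn_fmul_left,
        dualPairFn_fmul_left, show (fmul f ν).fst = fmul f ν.fst from rfl, lieFn_fmul]
      ring
  have hd0 (r : ℝ) : dFn (ContMDiffMap.const r : Fn E M) = 0 := by
    ext x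
    change mvfderiv 𝓘(ℝ, E) (fun _ : M => r) x _ = 0
    rw [mvfderiv_const]
    rfl
  refine ⟨⟨D, ⟨add_left, fun r ν τ => ?_, add_right, fun r ν τ => ?_⟩, derivation, fmul_left,
    fun ν f => dualPairFn_ext_right fun μ => ?_⟩, fun ν μ τ => hD ν τ μ⟩
  · rw [smul_eq_fmul, smul_eq_fmul, fmul_left, hd0]
    ext1 x
    exact (congrArg (_ + ·) (smul_zero _)).trans (add_zero _)
  · rw [smul_eq_fmul, smul_eq_fmul, derivation, lieFn_const]
    ext1 x
    exact (congrArg (_ + ·) (zero_smul _ _)).trans (add_zero _)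
  -- This axiom is where compatibility of the dull bracket with the projection to `TM` is needed.
  · rw [hD, dualPairFn_dFn, dualPairFn_dFn, dualPairFn_dFn, b.anchor, lieFn_vbr]
    ring

variable [SigmaCompactSpace M]

/-- With a connection `∇` on `A*`, the bracket `([X, Y], ∇_X β - ∇_Y α)` works: the derivative terms
of the vector field bracket match those of `∇`. No Jacobi identity or flatness is asked for. -/
theorem exists_dullBracket (A : VBundle.{uE, uM, w} E M) : Nonempty (DullBracket A) := by
  obtain ⟨N⟩ := exists_linConnection A.dual
  refine ⟨{
    br ν μ := pairSec (vbr ν.fst μ.fst) (N.D ν.fst μ.snd - N.D μ.fst ν.snd)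
    add_left ν ν' μ := ?_
    add_right ν μ μ' := ?_
    fmul_left f ν μ := ?_
    fmul_right ν f μ := ?_
    anchor ν μ := rfl }⟩
  · have h1 := vbr_add_left ν.fst ν'.fst μ.fst
    have h2 : N.D (ν.fst + ν'.fst) μ.snd - N.D μ.fst (ν.snd + ν'.snd)
      = (N.D ν.fst μ.snd - N.D μ.fst ν.snd) + (N.D ν'.fst μ.snd - N.D μ.fst ν'.snd) := by
      rw [N.add_left, N.add_right]; abel
    exact congrArg₂ pairSec h1 h2
  · have h1 := vbr_add ν.fst μ.fst μ'.fst
    have h2 : N.D ν.fst (μ.snd + μ'.snd) - N.D (μ.fst + μ'.fst) ν.snd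
      = (N.D ν.fst μ.snd - N.D μ.fst ν.snd) + (N.D ν.fst μ'.snd - N.D μ'.fst ν.snd) := by
      rw [N.add_left, N.add_right]; abel
    exact congrArg₂ pairSec h1 h2
  · have h1 := vbr_fmul_left f ν.fst μ.fst
    have h2 : N.D (fmul f ν.fst) μ.snd - N.D μ.fst (fmul f ν.snd)
      = fmul f (N.D ν.fst μ.snd - N.D μ.fst ν.snd) - fmul (lieFn μ.fst f) ν.snd := by
      rw [N.fmul_left, N.leibniz, fmul_sub]; abel
    exact congrArg₂ pairSec h1 h2
  · have h1 := vbr_fmul ν.fst f μ.fst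
    have h2 : N.D ν.fst (fmul f μ.snd) - N.D (fmul f μ.fst) ν.snd
      = fmul f (N.D ν.fst μ.snd - N.D μ.fst ν.snd) + fmul (lieFn ν.fst f) μ.snd := by
      rw [N.fmul_left, N.leibniz, fmul_sub]; abel
    exact congrArg₂ pairSec h1 h2

/-- There are Dorfman connections that extend the Lie derivative of a given Lie algebroid. -/
theorem LieTriple.exists_extends (T : LieTriple.{uE, uM, w, w₁} A) :
    ∃ Δ : DorfmanConnection A, Δ.Extends T := by
  obtain ⟨b⟩ := exists_dullBracket A
  obtain ⟨p, hadd, hmul, hp⟩ := T.ι.exists_retraction T.ι_injective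
  have hι (u) : (T.ι.map u).fst = T.lie.anchor.map u := by
    ext x
    exact T.ι_anchor x (u x)
  -- Both brackets obey the same Leibniz rules, as `ι` respects the anchors, so their difference is
  -- tensorial; both cover the bracket of vector fields, so its `TM` component vanishes.
  let c (u v : Sec T.U) : Sec A.Q := T.ι.map (T.lie.bracket u v) - b.br (T.ι.map u) (T.ι.map v)
  have c_add_left (u u' v) : c (u + u') v = c u v + c u' v := by
    simp only [c, T.lie.bilinear.add_left, VBHom.map_add, b.add_left]; abel
  have c_add_right (u v v') : c u (v + v') = c u v + c u v' := by
    simp only [c, T.lie.bilinear.add_right, VBHom.map_add, b.add_right]; abel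
  have c_left (f : Fn E M) (u v) : c (fmul f u) v = fmul f (c u v) := by
    simp only [c, T.lie.bracket_fmul_left, VBHom.map_sub, VBHom.map_fmul, b.fmul_left, hι,
      fmul_sub]
    abel
  have c_right (f : Fn E M) (u v) : c u (fmul f v) = fmul f (c u v) := by
    simp only [c, T.lie.leibniz, VBHom.map_add, VBHom.map_fmul, b.fmul_right, hι, fmul_sub]
    abel
  have c_anchor (u v) : (c u v).fst = 0 := by
    change (T.ι.map (T.lie.bracket u v)).fst - (b.br (T.ι.map u) (T.ι.map v)).fst = 0
    rw [hι, b.anchor, hι, hι, T.lie.anchor_bracket, sub_self]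
  -- Precomposing `c` with the retraction `p` extends it to `TM ⊕ A*`. Adding this tensor preserves
  -- the dull bracket axioms and, on `ι(U)`, replaces `b` by the bracket of `U`.
  let b' : DullBracket A :=
    { br := fun ν μ => b.br ν μ + c (p ν) (p μ)
      add_left := fun ν ν' μ => by rw [b.add_left, hadd, c_add_left]; abel
      add_right := fun ν μ μ' => by rw [b.add_right, hadd, c_add_right]; abel
      fmul_left := fun f ν μ => by rw [b.fmul_left, hmul, c_left, fmul_add]; abel
      fmul_right := fun ν f μ => by rw [b.fmul_right, hmul, c_right, fmul_add]; abel
      anchor := fun ν μ => by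
        change (b.br ν μ).fst + (c (p ν) (p μ)).fst = _
        rw [c_anchor, b.anchor, add_zero] }
  obtain ⟨Δ, hΔ⟩ := b'.exists_dorfman
  refine ⟨Δ, fun u v τ => ?_⟩
  have h : b'.br (T.ι.map u) (T.ι.map v) = T.ι.map (T.lie.bracket u v) := by
    simp only [b', hp, c]; abel
  rw [hΔ, h, hι]

end Dull

/-- Keeping `p` a variable lets the kernel equality be substituted, so no transport between
quotients appears. -/
theorem exists_quotientEquiv_of_ker_eq {V W : Type*} [AddCommGroup V] [Module ℝ V]
    [AddCommGroup W] [Module ℝ W] {p : Submodule ℝ V} {f : V →ₗ[ℝ] W}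
    (hf : Function.Surjective f) (h : LinearMap.ker f = p) :
    ∃ e : (V ⧸ p) ≃ₗ[ℝ] W, ∀ v, e (Submodule.Quotient.mk v) = f v := by
  subst h
  exact ⟨f.quotKerEquivOfSurjective hf, fun _ => rfl⟩

/-! ### Structure of an `A`-Manin pair -/

section Manin

variable {E : Type uE} [NormedAddCommGroup E] [NormedSpace ℝ E] [FiniteDimensional ℝ E]
  {M : Type uM} [TopologicalSpace M] [ChartedSpace E M] [IsManifold 𝓘(ℝ, E) ∞ M] [T2Space M]
  {A : VBundle.{uE, uM, w} E M}

theorem evalSec_lieForm (X : Sec (tangent E M)) (θ : Sec (tangent E M).dual)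
    (Y : Sec (tangent E M)) :
    evalSec (lieForm X θ) Y = lieFn X (evalSec θ Y) - evalSec θ (vbr X Y) :=
  evalSec_ofTensorial _ _ _ Y

theorem evalSec_contrD (X : Sec (tangent E M)) (θ : Sec (tangent E M).dual)
    (Y : Sec (tangent E M)) :
    evalSec (contrD X θ) Y
      = lieFn X (evalSec θ Y) - lieFn Y (evalSec θ X) - evalSec θ (vbr X Y) :=
  evalSec_ofTensorial _ _ _ Y

theorem LieAlgebroid.evalSec_lieDual (LA : LieAlgebroid A) (a : Sec A) (α : Sec A.dual)
    (b : Sec A) : evalSec (LA.lieDual a α) b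
      = lieFn (LA.anchor.map a) (evalSec α b) - evalSec α (LA.bracket a b) :=
  evalSec_ofTensorial _ _ _ b

/-- A `C^∞(M)`-linear functional on one-forms that vanishes on exact forms vanishes. -/
theorem eq_zero_of_exact {φ : Sec (tangent E M).dual → Fn E M}
    (hadd : ∀ s t, φ (s + t) = φ s + φ t) (hmul : ∀ (f : Fn E M) s, φ (fmul f s) = f * φ s)
    (h : ∀ f, φ (dFn f) = 0) (θ : Sec (tangent E M).dual) : φ θ = 0 := by
  -- The functional is evaluation on a vector field `X`, which annihilates every function and is
  -- therefore zero.
  obtain ⟨X, hX⟩ := exists_sec_of_dual φ hadd hmul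
  have h0 : X = 0 := by
    ext1 x
    refine tangent_ext _ _ fun f => ?_
    have := congrArg (fun g : Fn E M => g x) ((hX (dFn f)).trans (h f))
    exact this.trans (map_zero (mvfderiv 𝓘(ℝ, E) f x)).symm
  rw [← hX, h0, evalSec_zero]

/-- As functions of `θ`, both sides obey the same Leibniz rule, so their difference is tensorial.
They agree on exact forms by the `differential` axiom, and exact forms detect everything. -/
theorem DorfmanConnection.D_zero_pair (Δ : DorfmanConnection A) (ν : Sec A.Q)
    (θ : Sec (tangent E M).dual) : Δ.D ν (pairSec 0 θ) = pairSec 0 (lieForm ν.fst θ) := by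
  refine dualPairFn_ext_right fun μ => ?_
  rw [dualPairFn_pairSec_zero, evalSec_lieForm, ← sub_eq_zero]
  refine eq_zero_of_exact (φ := fun θ => dualPairFn μ (Δ.D ν (pairSec 0 θ))
    - (lieFn ν.fst (evalSec θ μ.fst) - evalSec θ (vbr ν.fst μ.fst))) ?_ ?_ ?_ θ
  · intro s t
    rw [pairSec_zero_add, Δ.bilinear.add_right, dualPairFn_add_right, evalSec_add_left,
      evalSec_add_left, lieFn_add]
    ring
  · intro f s
    rw [pairSec_zero_fmul, Δ.derivation, dualPairFn_add_right, dualPairFn_fmul_right,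
      dualPairFn_fmul_right, dualPairFn_pairSec_zero, evalSec_fmul_left,
      evalSec_fmul_left, lieFn_mul]
    ring
  · intro f
    rw [Δ.differential, dualPairFn_dFn]
    change _ - (lieFn ν.fst (lieFn μ.fst f) - lieFn (vbr ν.fst μ.fst) f) = 0
    rw [lieFn_vbr]
    ring

section Courant

variable {C : VBundle.{uE, uM, w₁} E M} (c : CourantData C)

theorem CourantData.pair_add_left (s t r : Sec C) : c.pair (s + t) r = c.pair s r + c.pair t r := by
  ext x
  exact LinearMap.map_add₂ (c.pairing x) _ _ _

theorem CourantData.pair_sub_left (s t r : Sec C) : c.pair (s - t) r = c.pair s r - c.pair t r := by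
  ext x
  exact LinearMap.map_sub₂ (c.pairing x) _ _ _

theorem IsCourant.pair_comm {c : CourantData C} (hc : IsCourant c) (s t : Sec C) :
    c.pair s t = c.pair t s := by
  ext x
  exact hc.symm x _ _

end Courant

variable {LA : LieAlgebroid A}

theorem LieAlgebroid.dualPair_rr (LA : LieAlgebroid A) (x : M) (τ τ' : A.B.fib x) :
    dualPair x (LA.rr x τ) τ' = LA.degenerate.pairing x τ' τ := rfl

theorem LieAlgebroid.degenerate_symm (LA : LieAlgebroid A) (x : M) (τ τ' : A.B.fib x) :
    LA.degenerate.pairing x τ τ' = LA.degenerate.pairing x τ' τ :=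
  add_comm (τ'.2 (LA.anchor.app x τ.1) : ℝ) (τ.2 (LA.anchor.app x τ'.1) : ℝ)

theorem LieAlgebroid.dualPairFn_rrSec (LA : LieAlgebroid A) (τ τ' : Sec A.B) :
    dualPairFn (LA.rrSec τ) τ' = LA.degenerate.pair τ τ' := by
  ext x
  exact LA.degenerate_symm x _ _

theorem LieAlgebroid.degenerate_pair_zero_pair (LA : LieAlgebroid A) (θ : Sec (tangent E M).dual)
    (τ : Sec A.B) : LA.degenerate.pair (pairSec 0 θ) τ = evalSec θ (LA.anchor.map τ.fst) := by
  ext x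
  change (τ x).2 (LA.anchor.app x 0) + θ x (LA.anchor.app x (τ x).1) = _
  rw [map_zero, map_zero]
  exact zero_add _

theorem dualPair_zero_left (x : M) (τ : A.B.fib x) : dualPair x 0 τ = 0 := by
  rw [← sub_self (0 : A.Q.fib x), dualPair_sub_left, sub_self]

theorem dualPair_zero_pair (x : M) (ν : A.Q.fib x) (θ : (tangent E M).dual.fib x) :
    dualPair x ν (0, θ) = θ ν.1 := by
  change (ν.2 0 : ℝ) + θ ν.1 = θ ν.1
  rw [map_zero]
  exact zero_add _

theorem evalSec_neg {V : VBundle.{uE, uM, w₁} E M} (σ : Sec V.dual) (s : Sec V) :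
    evalSec σ (-s) = -evalSec σ s := by
  ext x
  exact map_neg (σ x) (s x)

/-- The pairing of the basic connection, in terms of the structure of `A ⊕ T*M`. -/
theorem LieAlgebroid.dualPairFn_nablaBas_sub (LA : LieAlgebroid A) (Δ : DorfmanConnection A)
    (ν : Sec A.Q) (τ τ' : Sec A.B) :
    LA.degenerate.pair (Δ.D ν τ) τ' + lieFn (LA.anchor.map τ.fst) (dualPairFn ν τ')
        - dualPairFn ν (LA.degenerate.bracket τ τ')
        - lieFn (LA.anchor.map τ'.fst) (dualPairFn ν τ)
      = dualPairFn (nablaBas LA Δ τ.fst ν) τ' := by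
  -- Only the `A` component of `τ` may survive. Splitting off the one-form makes its contribution
  -- explicit, and the Cartan formulas cancel it.
  have h1 : Δ.D ν τ = Δ.D ν (pairSec τ.fst 0) + pairSec 0 (lieForm ν.fst τ.snd) := by
    rw [← Δ.D_zero_pair, ← Δ.bilinear.add_right, pairSec_fst_add_snd]
  have h2 : dualPairFn (LA.lieQ τ.fst ν) τ' = evalSec (LA.lieDual τ.fst ν.snd) τ'.fst
    + evalSec τ'.snd (vbr (LA.anchor.map τ.fst) ν.fst) := rfl
  have h3 : dualPairFn ν (LA.degenerate.bracket τ τ') = evalSec ν.snd (LA.bracket τ.fst τ'.fst)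
    + evalSec (lieForm (LA.anchor.map τ.fst) τ'.snd - contrD (LA.anchor.map τ'.fst) τ.snd)
      ν.fst := rfl
  have h4 (τ : Sec A.B) : dualPairFn ν τ = evalSec ν.snd τ.fst + evalSec τ.snd ν.fst := rfl
  have h5 : dualPairFn ν (pairSec τ.fst 0) = evalSec ν.snd τ.fst := add_zero _
  have h6 (f : Fn E M) (X : Sec (tangent E M)) : evalSec (dFn f) X = lieFn X f := rfl
  rw [nablaBas, dualPairFn_add_left, dualPairFn_rrSec, CourantData.pair_sub_left,
    degenerate_pair_zero_pair, h1, CourantData.pair_add_left, degenerate_pair_zero_pair, h2, h3,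
    h4, h4, h5, h6, evalSec_lieDual, evalSec_sub_left, evalSec_lieForm, evalSec_lieForm,
    evalSec_contrD, lieFn_add, lieFn_add, vbr_skew ν.fst, evalSec_neg]
  ring

namespace ManinPair

variable (P : ManinPair.{uE, uM, w, w₁} LA)

theorem pairing_incl_incl (x : M) (u v : P.U.fib x) :
    P.courant.pairing x (P.incl.app x u) (P.incl.app x v) = 0 :=
  (P.lagrangian x _).2 ⟨u, rfl⟩ v

/-- `U` equals its orthogonal, and the pairing of `Φ(τ)` with `u` is `⟨ι(u), τ⟩`. -/
theorem mem_ann_iff (x : M) (τ : A.B.fib x) :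
    τ ∈ P.toLieTriple.ann x ↔ ∃ u, P.incl.app x u = P.Φ.app x τ := by
  rw [← P.lagrangian]
  refine forall_congr' fun u => ?_
  rw [P.isCourant.symm]
  exact iff_of_eq (congrArg (· = 0) (P.Φ_compat x u τ).symm)

/-- For every `τ'`, `⟨ι(u), τ'⟩ = ⟨u, Φ(τ')⟩ = ⟨Φ(τ), Φ(τ')⟩ = ⟨τ, τ'⟩_d`, which is `⟨(ρ, ρᵗ)τ,
τ'⟩`; the duality pairing is nondegenerate. -/
theorem ι_eq_rr {x : M} {τ : A.B.fib x} {u : P.U.fib x} (h : P.incl.app x u = P.Φ.app x τ) :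
    P.ι.app x u = LA.rr x τ := by
  refine dualPair_ext_left fun τ' => ?_
  rw [← P.Φ_compat, h, P.Φ_morphism.pairing, LA.dualPair_rr, LA.degenerate_symm]

theorem incl_eq_Φ {x : M} {τ : A.B.fib x} {u : P.U.fib x} (hτ : τ ∈ P.toLieTriple.ann x)
    (h : P.ι.app x u = LA.rr x τ) : P.incl.app x u = P.Φ.app x τ := by
  obtain ⟨u', hu'⟩ := (P.mem_ann_iff x τ).1 hτ
  rw [← hu', P.ι_injective x (h.trans (P.ι_eq_rr hu').symm)]

theorem ann_isotropic {x : M} {τ τ' : A.B.fib x} (hτ : τ ∈ P.toLieTriple.ann x)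
    (hτ' : τ' ∈ P.toLieTriple.ann x) : LA.degenerate.pairing x τ τ' = 0 := by
  obtain ⟨u, hu⟩ := (P.mem_ann_iff x τ).1 hτ
  obtain ⟨u', hu'⟩ := (P.mem_ann_iff x τ').1 hτ'
  rw [← P.Φ_morphism.pairing, ← hu, ← hu', P.pairing_incl_incl]

/-- The map `(u, τ) ↦ u ⊕ τ` at a point. -/
def sumMap (x : M) : P.U.fib x × A.B.fib x →L[ℝ] P.C.fib x :=
  (P.incl.app x).coprod (P.Φ.app x)

theorem sumMap_apply (x : M) (u : P.U.fib x) (τ : A.B.fib x) :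
    P.sumMap x (u, τ) = P.incl.app x u + P.Φ.app x τ := rfl

theorem secSmooth_sumMap : SecSmooth (V := P.U.prod A.B) P.sumMap := fun s =>
  (P.oplus s.fst s.snd).contMDiff

theorem sumMap_surjective (x : M) : Function.Surjective (P.sumMap x) := fun v => by
  obtain ⟨u, τ, h⟩ := P.Φ_spans x v
  exact ⟨(u, τ), h.symm⟩

/-- The condition `u + Φ(τ) = 0` says that `Φ(τ)` is the inclusion of `-u`, which is the source of
the sign in the graph. `ι_eq_rr` and `incl_eq_Φ` give the two directions. -/
theorem ker_sumMap (x : M) :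
    LinearMap.ker (P.sumMap x).toLinearMap = P.toLieTriple.graph LA x := by
  ext ⟨u, τ⟩
  constructor
  · intro h
    have h1 : P.incl.app x u + P.Φ.app x τ = 0 := h
    have h2 : P.incl.app x (-u) = P.Φ.app x τ := by
      rw [map_neg]
      exact neg_eq_of_add_eq_zero_right h1
    refine ⟨(P.mem_ann_iff x τ).2 ⟨_, h2⟩, ?_⟩
    have h3 := P.ι_eq_rr h2
    rw [map_neg] at h3
    exact neg_eq_iff_eq_neg.1 h3
  · rintro ⟨h1, h2⟩
    have h3 : P.incl.app x (-u) = P.Φ.app x τ := P.incl_eq_Φ h1 (by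
      rw [map_neg]
      exact neg_eq_iff_eq_neg.2 h2)
    change P.incl.app x u + P.Φ.app x τ = 0
    rw [← h3, map_neg, add_neg_cancel]

/-- `C` is the quotient of `U ⊕ A ⊕ T*M` by the graph. -/
theorem exists_quotEquiv (x : M) :
    ∃ e : ((P.U.fib x × A.B.fib x) ⧸ P.toLieTriple.graph LA x) ≃ₗ[ℝ] P.C.fib x,
      ∀ u τ, e (Submodule.Quotient.mk (u, τ)) = P.sumMap x (u, τ) := by
  obtain ⟨e, he⟩ := exists_quotientEquiv_of_ker_eq (V := P.U.fib x × A.B.fib x)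
    (P.sumMap_surjective x) (P.ker_sumMap x)
  exact ⟨e, fun u τ => he (u, τ)⟩

theorem anchor_sum (x : M) (u : P.U.fib x) (τ : A.B.fib x) :
    P.courant.anchor.app x (P.incl.app x u + P.Φ.app x τ)
      = (P.ι.app x u).1 + LA.anchor.app x τ.1 := by
  rw [map_add, P.ι_anchor, P.Φ_morphism.anchor]
  rfl

theorem pairing_sum (x : M) (u₁ u₂ : P.U.fib x) (τ₁ τ₂ : A.B.fib x) :
    P.courant.pairing x (P.incl.app x u₁ + P.Φ.app x τ₁) (P.incl.app x u₂ + P.Φ.app x τ₂)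
      = dualPair x (P.ι.app x u₁) τ₂ + dualPair x (P.ι.app x u₂) τ₁
        + dualPair x (LA.rr x τ₂) τ₁ := by
  rw [map_add, map_add, LinearMap.add_apply, LinearMap.add_apply, P.pairing_incl_incl,
    P.isCourant.symm x (P.Φ.app x τ₁) (P.incl.app x u₂), P.Φ_compat, P.Φ_compat,
    P.Φ_morphism.pairing, LA.dualPair_rr]
  ring

theorem pair_incl_Φ (u : Sec P.U) (τ : Sec A.B) :
    P.courant.pair (P.incl.map u) (P.Φ.map τ) = dualPairFn (P.ι.map u) τ := by
  ext x
  exact P.Φ_compat x _ _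

theorem pair_Φ_Φ (τ τ' : Sec A.B) :
    P.courant.pair (P.Φ.map τ) (P.Φ.map τ') = LA.degenerate.pair τ τ' := by
  ext x
  exact P.Φ_morphism.pairing x _ _

theorem anchor_Φ (τ : Sec A.B) : P.courant.anchor.map (P.Φ.map τ) = LA.anchor.map τ.fst := by
  ext1 x
  exact P.Φ_morphism.anchor x _

theorem ι_fst (u : Sec P.U) : (P.ι.map u).fst = P.courant.anchor.map (P.incl.map u) := by
  ext1 x
  exact P.ι_anchor x _

/-- A fibrewise surjective bundle map is surjective on global sections. Identities on `Γ(C)` can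
thus be checked on sections `u ⊕ τ`. -/
theorem exists_oplus [SigmaCompactSpace M] (s : Sec P.C) :
    ∃ (u : Sec P.U) (τ : Sec A.B), P.oplus u τ = s := by
  obtain ⟨t, ht⟩ := P.secSmooth_sumMap.exists_lift P.sumMap_surjective s
  refine ⟨t.fst, t.snd, ?_⟩
  ext1 x
  exact ht x

theorem oplus_zero (τ : Sec A.B) : P.oplus 0 τ = P.Φ.map τ := by
  ext1 x
  change P.incl.app x 0 + P.Φ.app x (τ x) = P.Φ.app x (τ x)
  rw [map_zero, zero_add]

theorem pair_differential (f : Fn E M) (s : Sec P.C) :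
    P.courant.pair (P.oplus 0 (pairSec 0 (dFn f))) s = lieFn (P.courant.anchor.map s) f := by
  ext x
  obtain ⟨u, τ, h⟩ := P.Φ_spans x (s x)
  change P.courant.pairing x (P.incl.app x 0 + P.Φ.app x (0, mvfderiv 𝓘(ℝ, E) f x)) (s x)
    = mvfderiv 𝓘(ℝ, E) f x (P.courant.anchor.app x (s x))
  rw [h, P.pairing_sum, P.anchor_sum, map_zero, map_add, dualPair_zero_left, dualPair_zero_pair,
    dualPair_zero_pair, zero_add]
  rfl

/-- The discrepancy between `Φ(Δ_u τ)` and `⟦u, Φ(τ)⟧` is tested first against `U`, to see that it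
lies in `U`, and then against the image of `Φ`, to identify it. -/
theorem exists_bracket_incl_Φ {Δ : DorfmanConnection A} (hΔ : Δ.Extends P.toLieTriple)
    (u : Sec P.U) (τ : Sec A.B) : ∃ r : Sec P.U,
      P.ι.map r = nablaBas LA Δ τ.fst (P.ι.map u) ∧
      P.courant.bracket (P.incl.map u) (P.Φ.map τ)
        = P.Φ.map (Δ.D (P.ι.map u) τ) - P.incl.map r := by
  let s := P.Φ.map (Δ.D (P.ι.map u) τ) - P.courant.bracket (P.incl.map u) (P.Φ.map τ)
  have hs (v : Sec P.U) : P.courant.pair s (P.incl.map v) = 0 := by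
    -- Invariance expresses `⟨⟦u, Φ(τ)⟧, v⟩` by the same formula that the extension property gives
    -- for `⟨ι(v), Δ_u τ⟩`.
    have h1 := P.isCourant.invariant (P.incl.map u) (P.Φ.map τ) (P.incl.map v)
    have h2 : dualPairFn (P.ι.map v) (Δ.D (P.ι.map u) τ)
      = lieFn (P.courant.anchor.map (P.incl.map u)) (dualPairFn (P.ι.map v) τ)
        - dualPairFn (P.ι.map (P.bracketU u v)) τ := hΔ u v τ
    rw [← P.incl_bracketU, P.isCourant.pair_comm (P.Φ.map τ), P.isCourant.pair_comm (P.Φ.map τ),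
      P.pair_incl_Φ, P.pair_incl_Φ] at h1
    rw [P.courant.pair_sub_left, P.isCourant.pair_comm, P.pair_incl_Φ, h2, h1]
    ring
  have hs' (x) : ∃ v, P.incl.app x v = s x := (P.lagrangian x _).1 fun v => by
    obtain ⟨v, rfl⟩ := exists_sec_apply (E := E) v
    exact congrArg (fun f : Fn E M => f x) (hs v)
  have hr := P.incl.map_lift P.incl_injective s hs'
  set r := P.incl.lift P.incl_injective s hs'
  refine ⟨r, dualPairFn_ext_left fun τ' => ?_, by rw [hr]; exact (sub_sub_cancel _ _).symm⟩
  rw [← P.pair_incl_Φ, hr, P.courant.pair_sub_left, P.pair_Φ_Φ]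
  -- Reversing the bracket allows invariance along `Φ(τ)` to be used, and there `⟦Φ(τ), Φ(τ')⟧` is
  -- known because `Φ` is a morphism.
  have h1 := P.isCourant.symm_part (P.incl.map u) (P.Φ.map τ) (P.Φ.map τ')
  have h2 := P.isCourant.invariant (P.Φ.map τ) (P.incl.map u) (P.Φ.map τ')
  rw [P.courant.pair_add_left, P.pair_incl_Φ, P.anchor_Φ] at h1
  rw [← P.Φ_morphism.bracket, P.pair_incl_Φ, P.pair_incl_Φ, P.anchor_Φ] at h2
  rw [← LA.dualPairFn_nablaBas_sub Δ (P.ι.map u) τ τ']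
  linear_combination -h2 - h1

/-- The symmetric part of the bracket is `𝒟⟨u, Φ(τ)⟩`, and `𝒟 f = Φ(0, df)`. This produces the exact
term in the final bracket formula. -/
theorem bracket_Φ_incl (u : Sec P.U) (τ : Sec A.B) :
    P.courant.bracket (P.Φ.map τ) (P.incl.map u)
      = P.Φ.map (pairSec 0 (dFn (dualPairFn (P.ι.map u) τ)))
        - P.courant.bracket (P.incl.map u) (P.Φ.map τ) := by
  refine eq_sub_of_add_eq (P.isCourant.sec_ext fun s => ?_)
  rw [P.isCourant.symm_part, P.isCourant.pair_comm, P.pair_incl_Φ, ← P.pair_differential,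
    P.oplus_zero]

theorem exists_bracket_oplus {Δ : DorfmanConnection A} (hΔ : Δ.Extends P.toLieTriple)
    (u₁ u₂ : Sec P.U) (τ₁ τ₂ : Sec A.B) : ∃ r : Sec P.U,
      P.ι.map r = P.ι.map (P.bracketU u₁ u₂) + nablaBas LA Δ τ₁.fst (P.ι.map u₂)
        - nablaBas LA Δ τ₂.fst (P.ι.map u₁) ∧
      P.courant.bracket (P.oplus u₁ τ₁) (P.oplus u₂ τ₂)
        = P.oplus r (LA.degenerate.bracket τ₁ τ₂ + Δ.D (P.ι.map u₁) τ₂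
          - Δ.D (P.ι.map u₂) τ₁ + pairSec 0 (dFn (dualPairFn (P.ι.map u₂) τ₁))) := by
  obtain ⟨r₂, h₂, hb₂⟩ := P.exists_bracket_incl_Φ hΔ u₁ τ₂
  obtain ⟨r₁, h₁, hb₁⟩ := P.exists_bracket_incl_Φ hΔ u₂ τ₁
  refine ⟨P.bracketU u₁ u₂ + r₁ - r₂, ?_, ?_⟩
  · rw [VBHom.map_sub, VBHom.map_add, h₁, h₂]
  · simp only [oplus, P.isCourant.bilinear.add_left, P.isCourant.bilinear.add_right,
      VBHom.map_sub, VBHom.map_add, ← P.Φ_morphism.bracket, P.bracket_Φ_incl, hb₁, hb₂,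
      P.incl_bracketU]
    abel

end ManinPair

end Manin

/-! ### Isomorphism of equivalent pairs and the bijection on classes -/

section Uniqueness

variable {E : Type uE} [NormedAddCommGroup E] [NormedSpace ℝ E] [FiniteDimensional ℝ E]
  {M : Type uM} [TopologicalSpace M] [ChartedSpace E M] [IsManifold 𝓘(ℝ, E) ∞ M] [T2Space M]
  {A : VBundle.{uE, uM, w} E M} {LA : LieAlgebroid A}

namespace ManinPair

/-- Equivalent `A`-Manin pairs are isomorphic. -/
theorem nonempty_maninIso [SigmaCompactSpace M] (P P' : ManinPair.{uE, uM, w, w₁} LA)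
    (h : P.toLieTriple.image = P'.toLieTriple.image) : Nonempty (ManinIso P P') := by
  have hrange (x) (u : P.U.fib x) : ∃ u', P'.ι.app x u' = P.ι.app x u := by
    have h1 : LinearMap.range (P.ι.app x).toLinearMap = LinearMap.range (P'.ι.app x).toLinearMap :=
      congrFun (congrArg Prod.fst h) x
    have h2 : P.ι.app x u ∈ LinearMap.range (P'.ι.app x).toLinearMap := h1 ▸ ⟨u, rfl⟩
    exact h2
  have hrange' (x) (u' : P'.U.fib x) : ∃ u, P.ι.app x u = P'.ι.app x u' := by
    have h1 : LinearMap.range (P.ι.app x).toLinearMap = LinearMap.range (P'.ι.app x).toLinearMap :=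
      congrFun (congrArg Prod.fst h) x
    have h2 : P'.ι.app x u' ∈ LinearMap.range (P.ι.app x).toLinearMap := h1 ▸ ⟨u', rfl⟩
    exact h2
  choose f hf using hrange
  -- `ψ` is `ι'⁻¹ ∘ ι`, defined because the ranges agree; injectivity of `ι'` yields linearity here
  -- and smoothness below.
  let ψ (x) : P.U.fib x →L[ℝ] P'.U.fib x := LinearMap.toContinuousLinearMap
    { toFun := f x
      map_add' := fun u v => P'.ι_injective x (by rw [hf, map_add, map_add, hf, hf])
      map_smul' := fun r v => P'.ι_injective x (by
        rw [hf, map_smul, map_smul, hf, RingHom.id_apply]) }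
  have hψ (x u) : P'.ι.app x (ψ x u) = P.ι.app x u := hf x u
  have hψs : SecSmooth ψ := fun s => P'.ι.secSmooth.contMDiff_of_injective P'.ι_injective
    ((P.ι.map s).contMDiff.congr fun x => by rw [hψ]; rfl)
  have hψι (u : Sec P.U) : P'.ι.map (hψs.toVBHom.map u) = P.ι.map u := by
    ext1 x
    exact hψ x _
  -- Annihilator and graph depend only on `ι(U)` and `A`, so `(ψ, id)` carries one kernel into the
  -- other.
  have hker (x u τ) (h0 : P.sumMap x (u, τ) = 0) : P'.sumMap x (ψ x u, τ) = 0 := by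
    have h1 : (u, τ) ∈ P.toLieTriple.graph LA x := P.ker_sumMap x ▸ LinearMap.mem_ker.2 h0
    have h2 : (ψ x u, τ) ∈ P'.toLieTriple.graph LA x := by
      refine ⟨fun v => ?_, (hψ x u).trans h1.2⟩
      obtain ⟨v', hv'⟩ := hrange' x v
      have h3 : dualPair x (P.ι.app x v') τ = 0 := h1.1 v'
      rw [hv'] at h3
      exact h3
    rw [← P'.ker_sumMap] at h2
    exact h2
  -- `R` is an arbitrary linear splitting in each fibre, with no smoothness in `x`. By `hker` the
  -- map `Θ` does not depend on it, and smoothness of `Θ` is checked on sections `u ⊕ τ`.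
  choose R hR using fun x => LinearMap.exists_rightInverse_of_surjective (P.sumMap x).toLinearMap
    (LinearMap.range_eq_top.2 (P.sumMap_surjective x))
  have hR' (x v) : P.sumMap x (R x v) = v := LinearMap.congr_fun (hR x) v
  let Θ (x) : P.C.fib x →L[ℝ] P'.C.fib x := LinearMap.toContinuousLinearMap
    ((P'.sumMap x).toLinearMap ∘ₗ ((ψ x).toLinearMap.prodMap LinearMap.id) ∘ₗ R x)
  have hΘ (x u τ) : Θ x (P.sumMap x (u, τ)) = P'.sumMap x (ψ x u, τ) := by
    have h1 : P'.sumMap x (ψ x ((R x (P.sumMap x (u, τ))).1 - u),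
        (R x (P.sumMap x (u, τ))).2 - τ) = 0 := hker x _ _ (by
      have := hR' x (P.sumMap x (u, τ))
      rw [← sub_eq_zero, ← map_sub] at this
      exact this)
    rw [map_sub, ← Prod.mk_sub_mk, map_sub] at h1
    exact sub_eq_zero.1 h1
  have hΘs : SecSmooth Θ := fun s => by
    obtain ⟨u, τ, rfl⟩ := P.exists_oplus s
    exact (P'.oplus (hψs.toVBHom.map u) τ).contMDiff.congr fun x => by
      congr 1
      exact hΘ x _ _
  have hΘoplus (u τ) : hΘs.toVBHom.map (P.oplus u τ) = P'.oplus (hψs.toVBHom.map u) τ := by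
    ext1 x
    exact hΘ x _ _
  -- This uses the second component of `LieTriple.image`: equal graphs of brackets make `ψ` a
  -- morphism of brackets.
  have hbr (u v) : P'.bracketU (hψs.toVBHom.map u) (hψs.toVBHom.map v)
      = hψs.toVBHom.map (P.bracketU u v) := by
    have h1 : (P.ι.map u, P.ι.map v, P.ι.map (P.bracketU u v)) ∈ P'.toLieTriple.image.2 :=
      h ▸ ⟨u, v, rfl⟩
    obtain ⟨u', v', h2⟩ := h1
    have inj {s t : Sec P'.U} (hst : P'.ι.map s = P'.ι.map t) : s = t := by
      ext1 x
      exact P'.ι_injective x (congrArg (fun s : Sec A.Q => s x) hst)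
    have hu : hψs.toVBHom.map u = u' := inj ((hψι u).trans (congrArg Prod.fst h2))
    have hv : hψs.toVBHom.map v = v' := inj ((hψι v).trans (congrArg (fun p => p.2.1) h2))
    rw [hu, hv]
    exact inj ((congrArg (fun p => p.2.2) h2).symm.trans (hψι _).symm)
  have hanchor (x v) : P'.courant.anchor.app x (Θ x v) = P.courant.anchor.app x v := by
    obtain ⟨⟨u, τ⟩, rfl⟩ := P.sumMap_surjective x v
    rw [hΘ, sumMap_apply, sumMap_apply, anchor_sum, anchor_sum, hψ]
  have hpairing (x v v') : P'.courant.pairing x (Θ x v) (Θ x v') = P.courant.pairing x v v' := by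
    obtain ⟨⟨u, τ⟩, rfl⟩ := P.sumMap_surjective x v
    obtain ⟨⟨u', τ'⟩, rfl⟩ := P.sumMap_surjective x v'
    rw [hΘ, hΘ, sumMap_apply, sumMap_apply, sumMap_apply, sumMap_apply, pairing_sum, pairing_sum,
      hψ, hψ]
  -- A single `Δ` serves both pairs, since the extension property concerns only `ι(U)` with its
  -- anchor and bracket; the two bracket formulas then become comparable.
  obtain ⟨Δ, hΔ⟩ := P.toLieTriple.exists_extends
  have hψsurj (u' : Sec P'.U) : ∃ u, hψs.toVBHom.map u = u' := by
    refine ⟨P.ι.lift P.ι_injective (P'.ι.map u') fun x => hrange' x (u' x), ?_⟩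
    ext1 x
    refine P'.ι_injective x ((hψ x _).trans ?_)
    exact congrArg (fun s : Sec A.Q => s x) (P.ι.map_lift P.ι_injective (P'.ι.map u') _)
  have hΔ' : Δ.Extends P'.toLieTriple := fun u' v' τ => by
    obtain ⟨u, rfl⟩ := hψsurj u'
    obtain ⟨v, rfl⟩ := hψsurj v'
    have h1 : dualPairFn (P.ι.map v) (Δ.D (P.ι.map u) τ)
      = lieFn (P.courant.anchor.map (P.incl.map u)) (dualPairFn (P.ι.map v) τ)
        - dualPairFn (P.ι.map (P.bracketU u v)) τ := hΔ u v τ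
    change dualPairFn (P'.ι.map _) (Δ.D (P'.ι.map _) τ)
      = lieFn (P'.courant.anchor.map (P'.incl.map _)) (dualPairFn (P'.ι.map _) τ)
        - dualPairFn (P'.ι.map (P'.bracketU _ _)) τ
    rw [hbr, hψι, hψι, hψι, h1, ← P'.ι_fst, ← P.ι_fst, hψι]
  exact ⟨{
    Θ := hΘs.toVBHom
    Θ_bijective := fun x => by
      refine ⟨(injective_iff_map_eq_zero (Θ x)).2 fun v hv => ?_, fun v' => ?_⟩
      -- A map that preserves pairings is injective when the source pairing is nondegenerate.
      · refine P.isCourant.nondegenerate x v fun v' => ?_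
        rw [← hpairing, hv, map_zero, LinearMap.zero_apply]
      · obtain ⟨⟨u', τ⟩, rfl⟩ := P'.sumMap_surjective x v'
        obtain ⟨u, hu⟩ := hrange' x u'
        refine ⟨P.sumMap x (u, τ), (hΘ x u τ).trans ?_⟩
        rw [P'.ι_injective x ((hψ x u).trans hu)]
    Θ_courant :=
      { anchor := hanchor
        pairing := hpairing
        bracket := fun s t => by
          obtain ⟨u₁, τ₁, rfl⟩ := P.exists_oplus s
          obtain ⟨u₂, τ₂, rfl⟩ := P.exists_oplus t
          obtain ⟨r, hr, hb⟩ := P.exists_bracket_oplus hΔ u₁ u₂ τ₁ τ₂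
          obtain ⟨r', hr', hb'⟩ := P'.exists_bracket_oplus hΔ' (hψs.toVBHom.map u₁)
            (hψs.toVBHom.map u₂) τ₁ τ₂
          simp only [hbr, hψι] at hr' hb'
          -- The `U` components are compared inside `TM ⊕ A*`, where both formulas give the same
          -- section.
          have hrr : hψs.toVBHom.map r = r' := by
            ext1 x
            refine P'.ι_injective x ((hψ x _).trans ?_)
            exact congrArg (fun s : Sec A.Q => s x) (hr.trans hr'.symm)
          rw [hb, hΘoplus, hΘoplus, hΘoplus, hb', hrr] }
    ψ := hψs.toVBHom
    ψ_bijective := fun x => by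
      refine ⟨fun u v huv => P.ι_injective x ?_, fun u' => ?_⟩
      · rw [← hψ, ← hψ]
        exact congrArg (P'.ι.app x) huv
      · obtain ⟨u, hu⟩ := hrange' x u'
        exact ⟨u, P'.ι_injective x ((hψ x u).trans hu)⟩
    Θ_incl := fun x u => by
      have h1 := hΘ x u 0
      rw [sumMap_apply, sumMap_apply, map_zero, map_zero, add_zero, add_zero] at h1
      exact h1
    ψ_ι := hψ
    Θ_Φ := fun x τ => by
      have h1 := hΘ x 0 τ
      rw [sumMap_apply, sumMap_apply, map_zero, map_zero, map_zero, zero_add, zero_add] at h1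
      exact h1 }⟩

end ManinPair

/-- Both equivalences are kernels of the invariant `LieTriple.image`, which gives injectivity.
Surjectivity holds because a Dirac bialgebroid comes by definition from some `A`-Manin pair. -/
theorem classMap_bijective (LA : LieAlgebroid A) :
    Function.Bijective (classMap.{uE, uM, w, w₁} LA) := by
  constructor
  · rintro ⟨P⟩ ⟨P'⟩ h
    exact Quotient.sound (s := maninSetoid LA)
      (Quotient.exact (s := diracSetoid LA) (a := P.toDirac) (b := P'.toDirac) h)
  · intro D
    induction D using Quotient.inductionOn with
    | h D =>
      obtain ⟨P, hP⟩ := D.exists_maninPair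
      exact ⟨Quotient.mk _ P, Quotient.sound (congrArg LieTriple.image hP)⟩

end Uniqueness

end DiracManin

end

/-! ### The complete correspondence -/

theorem mainTheorem4 {E : Type uE} [NormedAddCommGroup E] [NormedSpace ℝ E]
    [FiniteDimensional ℝ E] {M : Type uM} [TopologicalSpace M] [ChartedSpace E M]
    [IsManifold 𝓘(ℝ, E) ∞ M] [T2Space M] [SigmaCompactSpace M]
    {A : VBundle.{uE, uM, w} E M} (LA : LieAlgebroid A) :
    -- the map on equivalence classes is a bijection
    Function.Bijective (classMap.{uE, uM, w, w₁} LA) ∧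
    -- the class of `(A, U, ι)` determines `C` and `Φ` up to isomorphism
    (∀ P P' : ManinPair.{uE, uM, w, w₁} LA,
      P.toLieTriple.image = P'.toLieTriple.image → Nonempty (ManinIso P P')) ∧
    -- explicit description of `C` and `Φ`
    (∀ P : ManinPair.{uE, uM, w, w₁} LA,
      -- `Φ(τ)` lies in `U` if and only if `τ` lies in `U°`
      (∀ x τ, τ ∈ P.toLieTriple.ann x ↔ ∃ u, P.incl.app x u = P.Φ.app x τ) ∧
      -- on `U°`, the map `Φ` is `(ρ, ρᵗ)`
      (∀ x, ∀ τ ∈ P.toLieTriple.ann x,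
        ∃ u, P.ι.app x u = LA.rr x τ ∧ P.incl.app x u = P.Φ.app x τ) ∧
      -- `U°` is isotropic
      (∀ x, ∀ τ ∈ P.toLieTriple.ann x, ∀ τ' ∈ P.toLieTriple.ann x,
        LA.degenerate.pairing x τ τ' = 0) ∧
      -- `C` is the quotient of `U ⊕ A ⊕ T*M` by the graph, via `(u, τ) ↦ u ⊕ τ = u + Φ(τ)`
      (∃ (q : VBHom (P.U.prod A.B) P.C)
        (e : ∀ x, ((P.U.fib x × A.B.fib x) ⧸ P.toLieTriple.graph LA x) ≃ₗ[ℝ] P.C.fib x),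
        ∀ x u τ, q.app x (u, τ) = P.incl.app x u + P.Φ.app x τ ∧
          e x (Submodule.Quotient.mk (u, τ)) = q.app x (u, τ)) ∧
      -- the anchor
      (∀ x u τ, P.courant.anchor.app x (P.incl.app x u + P.Φ.app x τ)
        = (P.ι.app x u).1 + LA.anchor.app x τ.1) ∧
      -- the pairing
      (∀ x u₁ u₂ τ₁ τ₂,
        P.courant.pairing x (P.incl.app x u₁ + P.Φ.app x τ₁) (P.incl.app x u₂ + P.Φ.app x τ₂)
          = dualPair x (P.ι.app x u₁) τ₂ + dualPair x (P.ι.app x u₂) τ₁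
            + dualPair x (LA.rr x τ₂) τ₁) ∧
      -- the map `𝒟 f = 0 ⊕ (0, df)`
      (∀ (f : Fn E M) (s : Sec P.C),
        P.courant.pair (P.oplus 0 (pairSec 0 (dFn f))) s = lieFn (P.courant.anchor.map s) f) ∧
      -- the bracket, for every extension `Δ` of `L^U`, and there are such extensions
      (∃ Δ : DorfmanConnection A, Δ.Extends P.toLieTriple) ∧
      (∀ Δ : DorfmanConnection A, Δ.Extends P.toLieTriple →
        ∀ (u₁ u₂ : Sec P.U) (τ₁ τ₂ : Sec A.B), ∃ r : Sec P.U,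
          P.ι.map r = P.ι.map (P.bracketU u₁ u₂) + nablaBas LA Δ τ₁.fst (P.ι.map u₂)
            - nablaBas LA Δ τ₂.fst (P.ι.map u₁) ∧
          P.courant.bracket (P.oplus u₁ τ₁) (P.oplus u₂ τ₂)
            = P.oplus r (LA.degenerate.bracket τ₁ τ₂ + Δ.D (P.ι.map u₁) τ₂
              - Δ.D (P.ι.map u₂) τ₁ + pairSec 0 (dFn (dualPairFn (P.ι.map u₂) τ₁))))) := by
  refine ⟨classMap_bijective LA, fun P P' h => P.nonempty_maninIso P' h, fun P => ⟨P.mem_ann_iff,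
    fun x τ hτ => ?_, fun x τ hτ τ' hτ' => P.ann_isotropic hτ hτ', ?_, P.anchor_sum, P.pairing_sum,
    P.pair_differential, P.toLieTriple.exists_extends, fun Δ hΔ => P.exists_bracket_oplus hΔ⟩⟩
  · obtain ⟨u, hu⟩ := (P.mem_ann_iff x τ).1 hτ
    exact ⟨u, P.ι_eq_rr hu, hu⟩
  · choose e he using P.exists_quotEquiv
    exact ⟨P.secSmooth_sumMap.toVBHom, e, fun x u τ => ⟨rfl, he x u τ⟩⟩
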